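/- Setting. Let $K$ be a commutative $\mathbb{Q}$-algebra of functions of the times $t=(t_1=x,t_2,t_3,\dots)$, with commuting derivations $\partial_n=\partial/\partial t_n$, $\partial=\partial_1$. Let $$L=D^r+\sum_{l=0}^{r-2}u_lD^l+\sum_{c=1}^m\Phi_cD^{-1}\Psi_c ,\qquad r\ge 1,$$ be a solution of the constrained KP hierarchy: $\partial_nL=[(L^{n/r})_+,L]$, $\partial_n\Phi_c=(L^{n/r})_+(\Phi_c)$, $\partial_n\Psi_c=-((L^*)^{n/r})_+(\Psi_c)$, with an invertible tau-function $\tau$: for $W=\sum_{n\ge0}\tau^{-1}\,p_n(-[\partial])\tau\;D^{-n}$, where $p_n$ are the Schur polynomials and $[\partial]=(\partial_1,\frac12\partial_2,\frac13\partial_3,\dots)$, one has $L^{1/r}W=WD$, $LW=WD^r$ and $\partial_nW=-(L^{n/r})_-W$. A squared eigenfunction potential $S(f,g)$ satisfies $\partial_nS(f,g)=\mathrm{Res}\,(D^{-1}g(L^{n/r})_+fD^{-1})$ for all $n\ge1$ (so $\partial S(f,g)=fg$); this determines it up to a constant. Put $$L(f)=L_+(f)+\sum_c\Phi_cS(f,\Psi_c),\qquad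 L^*(g)=(L^*)_+(g)-\sum_c\Psi_cS(\Phi_c,g).$$ Potentials are chosen for all pairs of iterates $f=L^i(\Phi_c)$, $g=(L^*)^j(\Psi_d)$, with constants such that $\partial_rS(f,g)=S(L(f),g)-S(f,L^*(g))-\sum_eS(f,\Psi_e)S(\Phi_e,g)$. Transformations. Fix $a\ne b$. The Darboux–Bäcklund (DB) transformation with respect to $\Phi_a$ (assumed invertible) is, with $T=\Phi_aD\Phi_a^{-1}$: $L\mapsto\tilde L=TLT^{-1}=\tilde L_++\sum_c\tilde\Phi_cD^{-1}\tilde\Psi_c$, where $$\tilde\Phi_a=T(L(\Phi_a)),\quad \tilde\Psi_a=\Phi_a^{-1},\quad \tilde\Phi_c=T(\Phi_c),\quad \tilde\Psi_c=-\Phi_a^{-1}S(\Phi_a,\Psi_c)\ (c\ne a),\quad \tilde\tau=\Phi_a\tau .$$ The adjoint one with respect to $\Psi_b$ (assumed invertible) is, with $T=\Psi_bD\Psi_b^{-1}$: $L\mapsto\bar L=(T^*)^{-1}LT^*=\bar L_++\sum_c\bar\Phi_cD^{-1}\bar\Psi_c$, where $$\bar\Phi_b=-\Psi_b^{-1},\quad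 \bar\Psi_b=T(L^*(\Psi_b)),\quad \bar\Phi_c=-\Psi_b^{-1}S(\Phi_c,\Psi_b),\quad \bar\Psi_c=T(\Psi_c)\ (c\ne b),\quad \bar\tau=\Psi_b\tau .$$ The potentials of the transformed functions are potentials for the transformed operator, subject to the same requirement on constants, and their remaining constants of integration are fixed as follows. For the DB transformation, let $f=L^{i+1}(\Phi_a)$ if $c=a$ and $f=L^i(\Phi_c)$ if $c\ne a$; then $$S(\tilde L^i(\tilde\Phi_c),(\tilde L^*)^j(\tilde\Psi_d))=S(f,g)-f\,\frac{S(\Phi_a,g)}{\Phi_a}\quad (d\ne a,\ g=(L^*)^j(\Psi_d)),\qquad S(\tilde L^i(\tilde\Phi_c),\tilde\Psi_a)=\frac{f}{\Phi_a}.$$ For the adjoint transformation, let $g=(L^*)^{j+1}(\Psi_b)$ if $d=b$ and $g=(L^*)^j(\Psi_d)$ if $d\ne b$; then $$S(\bar L^i(\bar\Phi_c),(\bar L^*)^j(\bar\Psi_d))=S(f,g)-g\,\frac{S(f,\Psi_b)}{\Psi_b}\quad (c\ne b,\ f=L^i(\Phi_c)),\qquad S(\bar\Phi_b,(\bar L^*)^j(\bar\Psi_d))=-\frac{g}{\Psi_b}.$$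 A binary DB step consists of one DB transformation with respect to $\Phi_a$ and one adjoint DB transformation with respect to $\Psi_b$, in either order. The superscript $(n,n)$ denotes the result of $n$ binary steps from the initial data $(0,0)$. Proposition. Let $\chi_i=L^i(\Phi_a)$, $\chi^*_j=(L^*)^j(\Psi_b)$, $S_{ij}=S(\chi_i,\chi^*_j)$ be formed from the initial data, and let $\Delta_n=\det(S_{ij})_{0\le i,j\le n-1}$ ($\Delta_0=1$). Whenever $n\ge0$ binary steps have been performed, $\Delta_n$ is invertible and $$\frac{\tau^{(n,n)}}{\tau^{(0,0)}}=(-1)^n\prod_{j=0}^{n-1}S(\Phi_a^{(j,j)},\Psi_b^{(j,j)})=(-1)^n\Delta_n ,$$ $$\Phi_a^{(n,n)}=\frac{(-1)^n}{\Delta_n}\det\begin{pmatrix}(S_{ij})_{0\le i,j\le n-1}&(\chi_i)_{0\le i\le n-1}\\(S_{nj})_{0\le j\le n-1}&\chi_n\end{pmatrix},\qquad \Psi_b^{(n,n)}=\frac{(-1)^n}{\Delta_n}\det\begin{pmatrix}(S_{ij})_{0\le i,j\le n-1}&(S_{in})_{0\le i\le n-1}\\(\chi^*_j)_{0\le j\le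 n-1}&\chi^*_n\end{pmatrix},$$ $$S(\Phi_a^{(n,n)},\Psi_b^{(n,n)})=\frac{\Delta_{n+1}}{\Delta_n}.$$ -/

import Mathlib

/-- A commutative `ℚ`-algebra `K` of functions of the multi-time `t = (t₁ = x, t₂, t₃, …)`,
with the commuting derivations `flow n = ∂/∂tₙ`, `n ≥ 1`. -/
class MultiTime (K : Type*) [CommRing K] [Algebra ℚ K] where
  flow : ℕ+ → Derivation ℚ K K
  flow_comm : ∀ (n k : ℕ+) (f : K), flow n (flow k f) = flow k (flow n f)

open MultiTime (flow)

section Operators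

variable {K : Type*} [CommRing K] [Algebra ℚ K] [MultiTime K]

/-- The space derivative `∂ = ∂/∂x = ∂/∂t₁`. -/
def dx (f : K) : K := flow 1 f

/-- Formal pseudo-differential operators `∑_{k ≤ N} a_k D^k` with coefficients in `K`. -/
@[ext]
structure PDO (K : Type*) [CommRing K] where
  coeff : ℤ → K
  bdd : ∃ N : ℤ, ∀ k, N < k → coeff k = 0

namespace PDO

/-- The operator `f D^n`. -/
def single (n : ℤ) (f : K) : PDO K where
  coeff k := if k = n then f else 0
  bdd := ⟨n, fun _ hk => if_neg hk.ne'⟩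

/-- The operator of multiplication by `f`. -/
def func (f : K) : PDO K := single 0 f

/-- The operator `D^n`, `n ∈ ℤ`. -/
def D (n : ℤ) : PDO K := single n 1

/-- The operator product, from the generalized Leibniz rule
`(a D^i) (b D^j) = ∑_{l ≥ 0} (i choose l) a (∂^l b) D^(i + j - l)`, for `i, j ∈ ℤ`.
In the coefficient of `D^k` only finitely many pairs `(i, l)` contribute. -/
noncomputable instance : Mul (PDO K) where
  mul A B :=
    { coeff := fun k => ∑ᶠ p : ℤ × ℕ,
        (Ring.choose p.1 p.2 : ℤ) • (A.coeff p.1 * dx^[p.2] (B.coeff (k - p.1 + p.2)))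
      bdd := by
        obtain ⟨N, hN⟩ := A.bdd
        obtain ⟨M, hM⟩ := B.bdd
        refine ⟨N + M, fun k hk => finsum_eq_zero_of_forall_eq_zero fun p => ?_⟩
        by_cases h : N < p.1
        · rw [hN _ h, zero_mul, smul_zero]
        · have h0 : ∀ l : ℕ, dx^[l] (0 : K) = 0 := fun l =>
            Function.iterate_fixed (by simp [dx]) l
          rw [hM _ (by omega), h0, mul_zero, smul_zero] }

instance : One (PDO K) := ⟨D 0⟩

noncomputable instance : Pow (PDO K) ℕ := ⟨fun A n => npowRec n A⟩

/-- The purely differential part `A₊`. -/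
def pos (A : PDO K) : PDO K where
  coeff k := if 0 ≤ k then A.coeff k else 0
  bdd := by
    obtain ⟨N, hN⟩ := A.bdd
    exact ⟨N, fun k hk => by simp [hN k hk]⟩

/-- The purely pseudo-differential part `A₋`. -/
def neg (A : PDO K) : PDO K where
  coeff k := if k < 0 then A.coeff k else 0
  bdd := ⟨0, fun _ hk => if_neg hk.le.not_gt⟩

/-- The residue `Res A`, the coefficient of `D⁻¹`. -/
def res (A : PDO K) : K := A.coeff (-1)

/-- `A₊(f)`, the differential operator `A₊ = ∑_{k ≥ 0} a_k D^k` applied to the function `f`. -/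
noncomputable def applyPos (A : PDO K) (f : K) : K :=
  ∑ᶠ k : ℕ, A.coeff k * dx^[k] f

/-- `(A*)₊(g) = (A₊)*(g)`, the formal adjoint `∑_{k ≥ 0} (-D)^k a_k` of `A₊` applied to `g`. -/
noncomputable def adjApplyPos (A : PDO K) (g : K) : K :=
  ∑ᶠ k : ℕ, (-1) ^ k * dx^[k] (A.coeff k * g)

end PDO

/-- `pₙ(-[∂]) f` with `[∂] = (∂/∂t₁, ½ ∂/∂t₂, ⅓ ∂/∂t₃, …)` and the Schur polynomials
`∑ₙ λⁿ pₙ(s₁, s₂, …) = exp (∑ₗ λˡ sₗ)`, computed through their recursion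
`n pₙ(s) = ∑_{k=1}^n k s_k p_{n-k}(s)`. -/
noncomputable def schurNeg : ℕ → K → K
  | 0, f => f
  | n + 1, f =>
      -((1 / (n + 1 : ℚ)) • ∑ k : Fin (n + 1), flow (Nat.succPNat k) (schurNeg (n - k) f))
  decreasing_by omega

/-- The dressing operator `W = ∑_{n ≥ 0} (pₙ(-[∂]) τ / τ) D⁻ⁿ` of a function `τ`. -/
noncomputable def dressing (τ : K) : PDO K where
  coeff k := if k ≤ 0 then schurNeg (-k).toNat τ * Ring.inverse τ else 0
  bdd := ⟨0, fun _ hk => if_neg hk.not_ge⟩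

end Operators

/-- The quantities attached to a constrained KP Lax operator:
the Lax operator `L`, its root `root = L^(1/r)`, the functions
`phi c i = L^i(Φ_c)`, `psi d j = (L*)^j(Ψ_d)`, the squared eigenfunction potentials
`S c i d j = S(L^i(Φ_c), (L*)^j(Ψ_d))`, and the function `τ`.
In particular `phi c 0 = Φ_c` and `psi d 0 = Ψ_d`. -/
structure LaxData (K : Type*) [CommRing K] (m : ℕ) where
  L : PDO K
  root : PDO K
  phi : Fin m → ℕ → K
  psi : Fin m → ℕ → K
  S : Fin m → ℕ → Fin m → ℕ → K
  tau : K

section Hierarchy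

variable {K : Type*} [CommRing K] [Algebra ℚ K] [MultiTime K] {m : ℕ}

/-- `X.L` is a constrained KP Lax operator
`L = D^r + ∑_{l ≤ r-2} u_l D^l + ∑_a Φ_a D⁻¹ Ψ_a`, and the other quantities (except for `τ`)
are what their names say. -/
structure IsCKP (r : ℕ+) (X : LaxData K m) : Prop where
  monic : X.L.coeff (r : ℕ) = 1
  subleading : X.L.coeff ((r : ℕ) - 1) = 0
  order : ∀ k : ℤ, (r : ℕ) < k → X.L.coeff k = 0
  neg_part : ∀ k : ℤ, k < 0 → X.L.coeff k =
    ∑ c, (PDO.func (X.phi c 0) * PDO.D (-1) * PDO.func (X.psi c 0)).coeff k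
  root_monic : X.root.coeff 1 = 1
  root_order : ∀ k : ℤ, 1 < k → X.root.coeff k = 0
  root_pow : X.root ^ (r : ℕ) = X.L
  /-- `L(f) = L₊(f) + ∑_d Φ_d S(f, Ψ_d)` -/
  phi_succ : ∀ c i, X.phi c (i + 1) =
    X.L.applyPos (X.phi c i) + ∑ d, X.phi d 0 * X.S c i d 0
  /-- `L*(g) = (L*)₊(g) - ∑_c Ψ_c S(Φ_c, g)` -/
  psi_succ : ∀ d j, X.psi d (j + 1) =
    X.L.adjApplyPos (X.psi d j) - ∑ c, X.psi c 0 * X.S c 0 d j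
  /-- The defining equations `∂S(f, g)/∂tₙ = Res (D⁻¹ g (L^(n/r))₊ f D⁻¹)`. -/
  sep : ∀ c i d j (n : ℕ+), flow n (X.S c i d j) =
    (PDO.D (-1) * PDO.func (X.psi d j) * (X.root ^ (n : ℕ)).pos * PDO.func (X.phi c i)
      * PDO.D (-1)).res
  /-- The constants of integration of the potentials: the two sides of
  `∂S(f, g)/∂t_r = S(L(f), g) - S(f, L*(g)) - ∑_e S(f, Ψ_e) S(Φ_e, g)`
  differ by a constant in any case, and this constant is `0`. -/
  sep_norm : ∀ c i d j, flow r (X.S c i d j) =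
    X.S c (i + 1) d j - X.S c i d (j + 1) - ∑ e, X.S c i e 0 * X.S e 0 d j

/-- The hierarchy: `X` is a solution of the `cKP_{r,m}` hierarchy with tau-function `X.tau`. -/
structure IsCKPSolution (r : ℕ+) (X : LaxData K m) : Prop extends IsCKP r X where
  /-- the Lax equations `∂L/∂tₙ = [(L^(n/r))₊, L]` -/
  lax : ∀ (n : ℕ+) (k : ℤ), flow n (X.L.coeff k) =
    ((X.root ^ (n : ℕ)).pos * X.L).coeff k - (X.L * (X.root ^ (n : ℕ)).pos).coeff k
  /-- `Φ_c` is an eigenfunction -/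
  eigen : ∀ c (n : ℕ+), flow n (X.phi c 0) = (X.root ^ (n : ℕ)).applyPos (X.phi c 0)
  /-- `Ψ_c` is an adjoint eigenfunction -/
  adj_eigen : ∀ c (n : ℕ+), flow n (X.psi c 0) = -(X.root ^ (n : ℕ)).adjApplyPos (X.psi c 0)
  tau_unit : IsUnit X.tau
  /-- `L = W D^r W⁻¹` for the dressing operator `W` of `τ` -/
  dress : X.L * dressing X.tau = dressing X.tau * PDO.D (r : ℕ)
  dress_root : X.root * dressing X.tau = dressing X.tau * PDO.D 1
  /-- the Wilson-Sato equations `∂W/∂tₙ = -(L^(n/r))₋ W` -/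
  sato : ∀ (n : ℕ+) (k : ℤ), flow n ((dressing X.tau).coeff k) =
    -((X.root ^ (n : ℕ)).neg * dressing X.tau).coeff k

/-- `Y` is the Darboux-Bäcklund transform of `X` with respect to `Φ_a`:
`L ↦ T L T⁻¹` with `T = Φ_a D Φ_a⁻¹`. -/
structure IsDB (r : ℕ+) (a : Fin m) (X Y : LaxData K m) : Prop where
  unit : IsUnit (X.phi a 0)
  ckp : IsCKP r Y
  lax : Y.L * (PDO.func (X.phi a 0) * PDO.D 1 * PDO.func (Ring.inverse (X.phi a 0))) =
    (PDO.func (X.phi a 0) * PDO.D 1 * PDO.func (Ring.inverse (X.phi a 0))) * X.L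
  root : Y.root * (PDO.func (X.phi a 0) * PDO.D 1 * PDO.func (Ring.inverse (X.phi a 0))) =
    (PDO.func (X.phi a 0) * PDO.D 1 * PDO.func (Ring.inverse (X.phi a 0))) * X.root
  /-- `Φ_a ↦ T(L(Φ_a))` -/
  phi_self : Y.phi a 0 = X.phi a 0 * dx (X.phi a 1 * Ring.inverse (X.phi a 0))
  /-- `Ψ_a ↦ 1 / Φ_a` -/
  psi_self : Y.psi a 0 = Ring.inverse (X.phi a 0)
  /-- `Φ_c ↦ T(Φ_c)` for `c ≠ a` -/
  phi_ne : ∀ c, c ≠ a → Y.phi c 0 = X.phi a 0 * dx (X.phi c 0 * Ring.inverse (X.phi a 0))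
  /-- `Ψ_d ↦ -S(Φ_a, Ψ_d) / Φ_a` for `d ≠ a` -/
  psi_ne : ∀ d, d ≠ a → Y.psi d 0 = -(Ring.inverse (X.phi a 0) * X.S a 0 d 0)
  /-- `τ ↦ Φ_a τ` -/
  tau : Y.tau = X.phi a 0 * X.tau
  /-- Constants of integration: the potential of `T(f)` and `(T*)⁻¹(g) = -S(Φ_a, g) / Φ_a` is
  `S(f, g) - f S(Φ_a, g) / Φ_a`. Here `f = L^(i+1)(Φ_a)` or `f = L^i(Φ_c)`, `c ≠ a`. -/
  sep_ne : ∀ c i d j, d ≠ a → Y.S c i d j = X.S c (if c = a then i + 1 else i) d j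
    - X.phi c (if c = a then i + 1 else i) * Ring.inverse (X.phi a 0) * X.S a 0 d j
  /-- Constants of integration: the potential of `T(f)` and `1 / Φ_a` is `f / Φ_a`. -/
  sep_self : ∀ c i, Y.S c i a 0 =
    X.phi c (if c = a then i + 1 else i) * Ring.inverse (X.phi a 0)

/-- `Y` is the adjoint Darboux-Bäcklund transform of `X` with respect to `Ψ_b`:
`L ↦ (T*)⁻¹ L T*` with `T = Ψ_b D Ψ_b⁻¹`, `T* = -Ψ_b⁻¹ D Ψ_b`. -/
structure IsAdjDB (r : ℕ+) (b : Fin m) (X Y : LaxData K m) : Prop where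
  unit : IsUnit (X.psi b 0)
  ckp : IsCKP r Y
  lax : (PDO.func (-Ring.inverse (X.psi b 0)) * PDO.D 1 * PDO.func (X.psi b 0)) * Y.L =
    X.L * (PDO.func (-Ring.inverse (X.psi b 0)) * PDO.D 1 * PDO.func (X.psi b 0))
  root : (PDO.func (-Ring.inverse (X.psi b 0)) * PDO.D 1 * PDO.func (X.psi b 0)) * Y.root =
    X.root * (PDO.func (-Ring.inverse (X.psi b 0)) * PDO.D 1 * PDO.func (X.psi b 0))
  /-- `Φ_b ↦ -1 / Ψ_b` -/
  phi_self : Y.phi b 0 = -Ring.inverse (X.psi b 0)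
  /-- `Ψ_b ↦ T(L*(Ψ_b))` -/
  psi_self : Y.psi b 0 = X.psi b 0 * dx (X.psi b 1 * Ring.inverse (X.psi b 0))
  /-- `Φ_c ↦ -S(Φ_c, Ψ_b) / Ψ_b` for `c ≠ b` -/
  phi_ne : ∀ c, c ≠ b → Y.phi c 0 = -(Ring.inverse (X.psi b 0) * X.S c 0 b 0)
  /-- `Ψ_d ↦ T(Ψ_d)` for `d ≠ b` -/
  psi_ne : ∀ d, d ≠ b → Y.psi d 0 = X.psi b 0 * dx (X.psi d 0 * Ring.inverse (X.psi b 0))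
  /-- `τ ↦ Ψ_b τ` -/
  tau : Y.tau = X.psi b 0 * X.tau
  /-- Constants of integration: the potential of `(T*)⁻¹(f) = -S(f, Ψ_b) / Ψ_b` and `T(g)` is
  `S(f, g) - g S(f, Ψ_b) / Ψ_b`. Here `g = (L*)^(j+1)(Ψ_b)` or `g = (L*)^j(Ψ_d)`, `d ≠ b`. -/
  sep_ne : ∀ c i d j, c ≠ b → Y.S c i d j = X.S c i d (if d = b then j + 1 else j)
    - X.psi d (if d = b then j + 1 else j) * Ring.inverse (X.psi b 0) * X.S c i b 0
  /-- Constants of integration: the potential of `-1 / Ψ_b` and `T(g)` is `-g / Ψ_b`. -/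
  sep_self : ∀ d j, Y.S b 0 d j =
    -(X.psi d (if d = b then j + 1 else j) * Ring.inverse (X.psi b 0))

/-- One binary Darboux-Bäcklund step: a Darboux-Bäcklund transformation with respect to `Φ_a`
and an adjoint one with respect to `Ψ_b`, in either order. -/
def IsBinaryDB (r : ℕ+) (a b : Fin m) (X Z : LaxData K m) : Prop :=
  ∃ Y : LaxData K m, (IsDB r a X Y ∧ IsAdjDB r b Y Z) ∨ (IsAdjDB r b X Y ∧ IsDB r a Y Z)

end Hierarchy

section Determinants

variable {K : Type*} [CommRing K] {m : ℕ}

/-- The `n × n` matrix of the `S_{ab}^{(i-1,j-1)}`, `1 ≤ i, j ≤ n`. -/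
def sepMatrix (X : LaxData K m) (a b : Fin m) (n : ℕ) : Matrix (Fin n) (Fin n) K :=
  Matrix.of fun i j => X.S a i b j

/-- The `n × n` matrix of the `S_{ab}^{(i-1,j-1)}`, bordered by the last column
`L^{i-1}(Φ_a)`, the last row `S_{ab}^{(n,j-1)}` and the corner `L^n(Φ_a)`. -/
def borderedPhi (X : LaxData K m) (a b : Fin m) (n : ℕ) :
    Matrix (Fin n ⊕ Unit) (Fin n ⊕ Unit) K :=
  Matrix.fromBlocks (sepMatrix X a b n) (Matrix.of fun i _ => X.phi a i)
    (Matrix.of fun _ j => X.S a n b j) (Matrix.of fun _ _ => X.phi a n)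

/-- The `n × n` matrix of the `S_{ab}^{(i-1,j-1)}`, bordered by the last column
`S_{ab}^{(i-1,n)}`, the last row `(L*)^{j-1}(Ψ_b)` and the corner `(L*)^n(Ψ_b)`. -/
def borderedPsi (X : LaxData K m) (a b : Fin m) (n : ℕ) :
    Matrix (Fin n ⊕ Unit) (Fin n ⊕ Unit) K :=
  Matrix.fromBlocks (sepMatrix X a b n) (Matrix.of fun i _ => X.S a i b n)
    (Matrix.of fun _ j => X.psi b j) (Matrix.of fun _ _ => X.psi b n)

end Determinants

/-! One binary step replaces the infinite matrix (S_{ij}) by its Schur complement S_{i+1,j+1} −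
S_{i+1,0} S_{00}⁻¹ S_{0,j+1} with respect to S_{00}. It does the same, up to sign, to the borders
χ_i and χ*_j, and it multiplies τ by −S_{00} (`IsBinaryDB.isSchurStep`). Since a determinant is the
pivot times the determinant of the Schur complement, n steps are Gaussian elimination: the product
of the pivots is Δ_n, and the entries left over are quotients of bordered determinants by Δ_n
(`schurSteps_det`).

The analytic content is that the transformations are compatible with iteration: for g_j =
(L*)^j(Ψ_d), d ≠ a, the j-th iterate of the transformed Lax operator is −S(Φ_a, g_j)/Φ_a, and dually
(`IsDB.psi_eq`, `IsAdjDB.phi_eq`). Conjugation by T holds for the differential parts up to a term of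
order zero (`PDO.exists_star_symbol_eq`). From this alone `adj_darboux` and `apply_adj_darboux`
express the new differential part, applied to such a quotient, through the bilinear concomitant,
which is ∂_r S (`PDO.res_eq_concomitant`). The normalization of ∂_r S then produces S(Φ_a, L*(g)),
and the remaining sums cancel. -/

/-! ### Differential operators as polynomials: product and formal adjoint. -/

namespace DiffOp

open Polynomial

variable {K : Type*} [CommRing K] [Algebra ℚ K] (d : Derivation ℚ K K)

/-- The derivation `d` applied to the coefficients of a polynomial. -/
noncomputable def coeffDeriv : K[X] →ₗ[ℚ] K[X] :=
  Polynomial.lsum fun k => ((monomial k).restrictScalars ℚ).comp d.toLinearMap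

/-- Left multiplication by `D` on symbols, `q ↦ X q + ∂q`. -/
noncomputable def shift : Module.End ℚ K[X] :=
  LinearMap.mulLeft ℚ X + coeffDeriv d

/-- The product of differential operators on symbols: `∑ aₖ Xᵏ` stands for `∑ aₖ Dᵏ`. -/
noncomputable def star : K[X] →ₗ[ℚ] Module.End ℚ K[X] :=
  Polynomial.lsum fun k =>
    { toFun := fun a => LinearMap.mulLeft ℚ (C a) * shift d ^ k
      map_add' := fun a b => by ext1; simp [add_mul]
      map_smul' := fun c a => by ext1; simp [← smul_C] }

/-- The formal adjoint `g ↦ ∑ (-∂)ᵏ (aₖ g)` of `∑ aₖ Dᵏ`. -/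
noncomputable def adj : K[X] →ₗ[ℚ] Module.End ℚ K :=
  Polynomial.lsum fun k =>
    { toFun := fun a => (-d.toLinearMap) ^ k * LinearMap.mulLeft ℚ a
      map_add' := fun a b => by ext1; simp [add_mul]
      map_smul' := fun c a => by ext1; simp }

theorem coeffDeriv_monomial (k : ℕ) (a : K) :
    coeffDeriv d (monomial k a) = monomial k (d a) := by
  simp [coeffDeriv, Polynomial.lsum_apply, sum_monomial_index]

theorem star_monomial (k : ℕ) (a : K) (q : K[X]) :
    star d (monomial k a) q = C a * (shift d ^ k) q := by
  simp [star, Polynomial.lsum_apply, sum_monomial_index]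

theorem adj_monomial (k : ℕ) (a g : K) :
    adj d (monomial k a) g = ((-d.toLinearMap) ^ k) (a * g) := by
  simp [adj, Polynomial.lsum_apply, sum_monomial_index]

theorem coeff_coeffDeriv (p : K[X]) (k : ℕ) : (coeffDeriv d p).coeff k = d (p.coeff k) := by
  induction p using Polynomial.induction_on' with
  | add p q hp hq => simp [hp, hq]
  | monomial n a =>
    rw [coeffDeriv_monomial, coeff_monomial, coeff_monomial]
    split_ifs <;> simp

theorem shift_apply (q : K[X]) : shift d q = X * q + coeffDeriv d q := rfl

theorem coeffDeriv_C_mul (a : K) (q : K[X]) :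
    coeffDeriv d (C a * q) = C a * coeffDeriv d q + C (d a) * q := by
  ext k
  simp [coeff_coeffDeriv, mul_comm]

theorem coeffDeriv_mul_X (q : K[X]) : coeffDeriv d (q * X) = coeffDeriv d q * X := by
  ext k
  cases k <;> simp [coeff_coeffDeriv]

theorem shift_C_mul (a : K) (q : K[X]) :
    shift d (C a * q) = C a * shift d q + C (d a) * q := by
  rw [shift_apply, shift_apply, coeffDeriv_C_mul]; ring

theorem shift_mul_X (q : K[X]) : shift d (q * X) = shift d q * X := by
  rw [shift_apply, shift_apply, coeffDeriv_mul_X]; ring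

theorem coeffDeriv_C (a : K) : coeffDeriv d (C a) = C (d a) := by
  simpa using coeffDeriv_monomial d 0 a

theorem star_C (a : K) (q : K[X]) : star d (C a) q = C a * q := by
  simpa using star_monomial d 0 a q

theorem star_X (q : K[X]) : star d X q = shift d q := by
  rw [← monomial_one_one_eq_X, star_monomial, C_1, one_mul, pow_one]

theorem star_C_mul (a : K) (p q : K[X]) : star d (C a * p) q = C a * star d p q := by
  induction p using Polynomial.induction_on' with
  | add p p' hp hq => simp [hp, hq, mul_add]
  | monomial n b => simp [star_monomial, C_mul_monomial, mul_assoc]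

/-- This is (D p) q = D (p q), the case from which associativity follows by induction on the power
of D. -/
theorem star_shift (p q : K[X]) : star d (shift d p) q = shift d (star d p q) := by
  induction p using Polynomial.induction_on' with
  | add p p' hp hq => simp [hp, hq]
  | monomial n b =>
    simp [star_monomial, shift_apply d (monomial n b), coeffDeriv_monomial, shift_C_mul,
      X_mul_monomial, pow_succ']

/-- Products of differential operators are associative. -/
theorem star_assoc (p q s : K[X]) : star d (star d p q) s = star d p (star d q s) := by
  induction p using Polynomial.induction_on' with
  | add p p' hp hq => simp [hp, hq]
  | monomial n b =>
    rw [star_monomial, star_monomial, star_C_mul]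
    congr 1
    induction n with
    | zero => simp
    | succ n ih => rw [pow_succ', Module.End.mul_apply, Module.End.mul_apply, star_shift, ih]

/-- Coefficients stand to the left of the powers of D, so composing with D on the right is plain
multiplication by `X`. -/
theorem star_mul_X (p q : K[X]) : star d p (q * X) = star d p q * X := by
  induction p using Polynomial.induction_on' with
  | add p p' hp hq => simp [hp, hq, add_mul]
  | monomial n b =>
    rw [star_monomial, star_monomial, mul_assoc]
    congr 1
    induction n with
    | zero => simp
    | succ n ih => rw [pow_succ', Module.End.mul_apply, Module.End.mul_apply, ih, shift_mul_X]

theorem mul_X_star (p q : K[X]) : star d (p * X) q = star d p (shift d q) := by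
  induction p using Polynomial.induction_on' with
  | add p p' hp hq => simp [hp, hq, add_mul]
  | monomial n b => simp [star_monomial, monomial_mul_X, pow_succ]

theorem adj_mul_X (p : K[X]) (g : K) : adj d (p * X) g = -d (adj d p g) := by
  induction p using Polynomial.induction_on' with
  | add p p' hp hq => simp [hp, hq, add_mul]; ring
  | monomial n b => simp [adj_monomial, monomial_mul_X, pow_succ']

theorem adj_C (a g : K) : adj d (C a) g = a * g := by
  simpa using adj_monomial d 0 a g

theorem adj_C_mul (a : K) (p : K[X]) (g : K) : adj d (C a * p) g = adj d p (a * g) := by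
  induction p using Polynomial.induction_on' with
  | add p p' hp hq => simp [hp, hq, mul_add]
  | monomial n b =>
    simp only [adj_monomial, C_mul_monomial]
    congr 1; ring

/-- `(p f)* = f p*` for a differential operator `p` and a function `f`. -/
theorem adj_star_C (p : K[X]) (f g : K) : adj d (star d p (C f)) g = f * adj d p g := by
  induction p using Polynomial.induction_on' with
  | add p p' hp hq => simp [hp, hq, mul_add]
  | monomial n b =>
    induction n generalizing f with
    | zero => simp only [monomial_zero_left, star_C, ← C_mul, adj_C]; ring
    | succ n ih =>
      rw [← monomial_mul_X, mul_X_star, shift_apply, coeffDeriv_C, map_add, X_mul,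
        star_mul_X, map_add, LinearMap.add_apply, adj_mul_X, adj_mul_X, ih, ih, d.leibniz]
      simp only [smul_eq_mul]; ring

/-- ∂ commutes with the powers of −∂, so it passes to the products aₖ g and obeys the product rule
there. -/
theorem deriv_adj (p : K[X]) (g : K) :
    d (adj d p g) = adj d (coeffDeriv d p) g + adj d p (d g) := by
  induction p using Polynomial.induction_on' with
  | add p p' hp hq => simp [hp, hq]; ring
  | monomial n b =>
    rw [coeffDeriv_monomial]
    simp only [adj_monomial, ← map_add]
    have h : (d.toLinearMap : Module.End ℚ K) * (-d.toLinearMap) ^ n =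
        (-d.toLinearMap) ^ n * d.toLinearMap :=
      (Commute.neg_right (Commute.refl (d.toLinearMap : Module.End ℚ K))).pow_right n
    have := LinearMap.congr_fun h (b * g)
    simp only [Module.End.mul_apply, Derivation.coeFn_coe, Derivation.leibniz, smul_eq_mul] at this
    rw [this]; congr 1; ring

/-- Splitting off the last D: p = (`divX p`) D + p₀. The derivative produced here is what later
cancels against `deriv_adj`. -/
theorem adj_eq_divX (p : K[X]) (g : K) :
    adj d p g = -d (adj d p.divX g) + p.coeff 0 * g := by
  conv_lhs => rw [← divX_mul_X_add p]
  rw [map_add, LinearMap.add_apply, adj_mul_X, adj_C]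

/-! ### The concomitant and the two Darboux conjugations. -/

/-- The bilinear concomitant `Res (D⁻¹ g p f D⁻¹)`. -/
noncomputable def concomitant (p : K[X]) (g f : K) : K := adj d (divX (star d p (C f))) g

theorem divX_mul_X_add_eq {R : Type*} [CommRing R] (p q : R[X]) : divX (p * X + q) = p + divX q := by
  ext k; simp [coeff_divX]

/-- The differential part of `Φ D Φ⁻¹ P Φ D⁻¹ Φ⁻¹`, through its adjoint. -/
theorem adj_darboux {P P' : K[X]} {v c Φ Φ' S : K} (hΦ : Φ * Φ' = 1) (hv : d Φ = v * Φ)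
    (h : star d P' (X - C v) = star d (X - C v) P - C c) :
    adj d P' (-(Φ' * S)) = Φ' * (concomitant d P (Φ' * d S) Φ
      - (star d P (C Φ)).coeff 0 * Φ' * S) := by
  have hv' : d Φ' = -(v * Φ') := by
    have h0 : d (Φ * Φ') = 0 := by rw [hΦ, d.map_one_eq_zero]
    rw [d.leibniz, smul_eq_mul, smul_eq_mul, hv] at h0
    linear_combination Φ' * h0 - (d Φ' + v * Φ') * hΦ
  set Q := star d P (C Φ) with hQ
  -- D − v with v = ∂Φ/Φ is Φ D Φ⁻¹, so multiplying the intertwining relation by Φ on the right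
  -- leaves a bare D there.
  have e1 : star d (X - C v) (C Φ) = C Φ * X := by
    simp [star_X, star_C, shift_apply, coeffDeriv_C, hv]
  have e2 : star d P' (C Φ) * X = shift d Q - C v * Q - C (c * Φ) := by
    rw [← star_mul_X, ← e1, ← star_assoc, h]
    simp [star_X, star_C, star_shift, star_C_mul, hQ]
  -- Dividing by D on the right discards the coefficient of order zero, and with it the unknown c.
  have e3 : star d P' (C Φ) = Q + divX (coeffDeriv d Q - C v * Q) := by
    ext k
    have := congrArg (fun p => coeff p (k + 1)) e2
    simp [shift_apply] at this
    simp [coeff_divX, this]; ring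
  have e4 : adj d P' (-(Φ' * S)) = -(Φ' * adj d (star d P' (C Φ)) (Φ' * S)) := by
    rw [adj_star_C, map_neg]; linear_combination adj d P' (Φ' * S) * hΦ
  have e5 : divX (coeffDeriv d Q - C v * Q) = coeffDeriv d Q.divX - C v * Q.divX := by
    ext k; simp [coeff_divX, coeff_coeffDeriv]
  have e6 : Φ' * d S = d (Φ' * S) + v * (Φ' * S) := by
    rw [d.leibniz, smul_eq_mul, smul_eq_mul, hv']; ring
  rw [e4, e3, map_add, LinearMap.add_apply, e5, map_sub, LinearMap.sub_apply, adj_C_mul,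
    adj_eq_divX d Q, deriv_adj, concomitant, ← hQ, e6, map_add]
  ring

/-- The differential part of `Ψ⁻¹ D⁻¹ Ψ P Ψ⁻¹ D Ψ`. -/
theorem apply_adj_darboux {P P' : K[X]} {w c Ψ Ψ' S : K} (hΨ : Ψ * Ψ' = 1) (hw : d Ψ = w * Ψ)
    (h : star d (X + C w) P' = star d P (X + C w) + C c) :
    (star d P' (C (-(Ψ' * S)))).coeff 0 = -(Ψ' * (concomitant d P Ψ (Ψ' * d S)
      + adj d P Ψ * Ψ' * S)) := by
  have hw' : d Ψ' = -(w * Ψ') := by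
    have h0 : d (Ψ * Ψ') = 0 := by rw [hΨ, d.map_one_eq_zero]
    rw [d.leibniz, smul_eq_mul, smul_eq_mul, hw] at h0
    linear_combination Ψ' * h0 - (d Ψ' + w * Ψ') * hΨ
  -- The value sought is, up to sign, the order-zero coefficient of P' composed with multiplication
  -- by S/Ψ.
  set U := star d P' (C (Ψ' * S)) with hU
  have e1 : star d (X + C w) (C (Ψ' * S)) = C (Ψ' * S) * X + C (Ψ' * d S) := by
    have e6 : Ψ' * d S = d (Ψ' * S) + w * (Ψ' * S) := by
      rw [d.leibniz, smul_eq_mul, smul_eq_mul, hw']; ring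
    rw [e6, map_add, LinearMap.add_apply, star_X, star_C, shift_apply, coeffDeriv_C,
      C_add, C_mul (a := w)]
    ring
  have e2 : shift d U + C w * U = star d P (C (Ψ' * S)) * X + star d P (C (Ψ' * d S))
      + C (c * (Ψ' * S)) := by
    rw [← star_mul_X, ← map_add (star d P), ← e1, ← star_assoc, C_mul (a := c), ← star_C d c,
      ← LinearMap.add_apply, ← map_add (star d), ← h, star_assoc, map_add (star d),
      LinearMap.add_apply, star_X, star_C]
  have e3 : U + (coeffDeriv d U.divX + C w * U.divX) =
      star d P (C (Ψ' * S)) + divX (star d P (C (Ψ' * d S))) := by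
    ext k
    have := congrArg (fun p => coeff p (k + 1)) e2
    simp only [shift_apply, coeff_add, coeff_X_mul, coeff_mul_X, coeff_C_succ, coeff_C_mul,
      coeff_coeffDeriv, add_zero] at this
    simp only [coeff_add, coeff_divX, coeff_coeffDeriv, coeff_C_mul, ← this]; ring
  have e4 := congrArg (fun p => adj d p Ψ) e3
  simp only [map_add, LinearMap.add_apply, adj_C_mul, adj_star_C] at e4
  rw [adj_eq_divX d U, deriv_adj, hw] at e4
  rw [C_neg, map_neg, coeff_neg, ← hU, concomitant]
  -- In the adjoint applied to Ψ, the equation (D + w)* Ψ = −∂Ψ + wΨ = 0 removes all of U except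
  -- U₀Ψ.
  linear_combination Ψ' * -e4 + U.coeff 0 * hΨ

/-! ### Explicit coefficient formulas for products, adjoints and concomitants. -/

/-- The Leibniz rule for Dⁿ f. For k > n the truncated n − k is harmless, because the binomial
coefficient vanishes. -/
theorem shift_pow_C_coeff (n k : ℕ) (f : K) :
    ((shift d ^ n) (C f)).coeff k = n.choose k * d^[n - k] f := by
  induction n generalizing k with
  | zero => cases k <;> simp [coeff_C]
  | succ n ih =>
    rw [pow_succ', Module.End.mul_apply, shift_apply, coeff_add, coeff_coeffDeriv, ih]
    cases k with
    | zero => simp [Function.iterate_succ_apply']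
    | succ k =>
      rw [coeff_X_mul, ih, d.leibniz, d.map_natCast, smul_zero, add_zero, smul_eq_mul,
        ← Function.iterate_succ_apply' d, Nat.choose_succ_succ, Nat.succ_sub_succ]
      rcases Nat.lt_or_ge k n with h | h
      · rw [show (n - (k + 1)).succ = n - k by omega]; push_cast; ring
      · simp [Nat.choose_eq_zero_of_lt (show n < k + 1 by omega)]

theorem iterate_neg_pow (n : ℕ) (f : K) :
    ((-d.toLinearMap) ^ n) f = (-1) ^ n * d^[n] f := by
  induction n with
  | zero => simp
  | succ n ih =>
    rw [pow_succ', Module.End.mul_apply, ih, Function.iterate_succ_apply', LinearMap.neg_apply,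
      Derivation.coeFn_coe, d.leibniz, d.leibniz_pow]
    simp [pow_succ]

theorem coeff_star_C (p : K[X]) (f : K) (k N : ℕ) (hN : ∀ n, N ≤ n → p.coeff n = 0) :
    (star d p (C f)).coeff k =
      ∑ l ∈ Finset.range N, ((k + l).choose l : K) * (p.coeff (k + l) * d^[l] f) := by
  have hp : p = ∑ n ∈ Finset.range (k + N), monomial n (p.coeff n) := by
    ext j
    simp only [finsetSum_coeff, coeff_monomial, Finset.sum_ite_eq', Finset.mem_range]
    split_ifs with h
    · rfl
    · exact hN _ (by omega)
  conv_lhs => rw [hp]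
  simp only [map_sum, LinearMap.sum_apply, finsetSum_coeff, star_monomial, coeff_C_mul,
    shift_pow_C_coeff]
  rw [Finset.sum_range_add, Finset.sum_eq_zero, zero_add]
  · refine Finset.sum_congr rfl fun l _ => ?_
    rw [Nat.add_sub_cancel_left, Nat.choose_symm_add]; ring
  · intro j hj
    rw [Nat.choose_eq_zero_of_lt (Finset.mem_range.1 hj)]; simp

theorem coeff_zero_star_C (p : K[X]) (f : K) (N : ℕ) (hN : ∀ n, N ≤ n → p.coeff n = 0) :
    (star d p (C f)).coeff 0 = ∑ l ∈ Finset.range N, p.coeff l * d^[l] f := by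
  rw [coeff_star_C d p f 0 N hN]; simp

theorem adj_eq_sum (p : K[X]) (g : K) (N : ℕ) (hN : ∀ n, N ≤ n → p.coeff n = 0) :
    adj d p g = ∑ l ∈ Finset.range N, (-1) ^ l * d^[l] (p.coeff l * g) := by
  have hp : p = ∑ n ∈ Finset.range N, monomial n (p.coeff n) := by
    ext j
    simp only [finsetSum_coeff, coeff_monomial, Finset.sum_ite_eq', Finset.mem_range]
    split_ifs with h
    · rfl
    · exact hN _ (by omega)
  conv_lhs => rw [hp]
  simp only [map_sum, LinearMap.sum_apply, adj_monomial, iterate_neg_pow]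

/-- From D f = f D + ∂f, raising the order by one adds the term f (a Dⁿ)*(g) and differentiates f in
the rest. -/
theorem concomitant_monomial (n : ℕ) (a g f : K) :
    concomitant d (monomial n a) g f =
      ∑ l ∈ Finset.range n, (-1) ^ (n - 1 - l) * d^[n - 1 - l] (g * a) * d^[l] f := by
  induction n generalizing f with
  | zero => rw [concomitant, monomial_zero_left, star_C, ← C_mul, divX_C]; simp
  | succ n ih =>
    have : concomitant d (monomial (n + 1) a) g f =
        f * adj d (monomial n a) g + concomitant d (monomial n a) g (d f) := by
      rw [concomitant, ← monomial_mul_X, mul_X_star, shift_apply, coeffDeriv_C, map_add, X_mul,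
        star_mul_X, divX_mul_X_add_eq, map_add, LinearMap.add_apply, adj_star_C, concomitant]
    rw [this, ih, Finset.sum_range_succ', adj_monomial, iterate_neg_pow, add_comm]
    congr 1
    · refine Finset.sum_congr rfl fun l _ => ?_
      rw [Function.iterate_succ_apply, show n + 1 - 1 - (l + 1) = n - 1 - l by omega]
    · simp only [Nat.add_sub_cancel, Nat.sub_zero, Function.iterate_zero, id]
      rw [mul_comm a g]; ring

/-- The bilinear concomitant through the coefficients. -/
theorem concomitant_eq_sum (p : K[X]) (g f : K) (N : ℕ) (hN : ∀ n, N ≤ n → p.coeff n = 0) :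
    concomitant d p g f = ∑ l ∈ Finset.range N, (∑ n ∈ Finset.range N,
      (-1) ^ n * d^[n] (g * p.coeff (l + 1 + n))) * d^[l] f := by
  have hp : p = ∑ n ∈ Finset.range N, monomial n (p.coeff n) := by
    ext j
    simp only [finsetSum_coeff, coeff_monomial, Finset.sum_ite_eq', Finset.mem_range]
    split_ifs with h
    · rfl
    · exact hN _ (by omega)
  have hlin : concomitant d p g f =
      ∑ k ∈ Finset.range N, concomitant d (monomial k (p.coeff k)) g f := by
    have hdiv : ∀ q : K[X], divX q = divX_hom q := fun _ => rfl
    conv_lhs => rw [hp]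
    simp only [concomitant, map_sum, LinearMap.sum_apply, hdiv]
  rw [hlin]
  simp only [concomitant_monomial, Finset.sum_mul]
  rw [Finset.sum_sigma', Finset.sum_sigma']
  -- The l-th term of the monomial of order k corresponds to (l, n) with k = l + 1 + n; the pairs
  -- with l + 1 + n ≥ N contribute zero.
  refine Finset.sum_bij_ne_zero (fun x _ _ => ⟨x.2, x.1 - 1 - x.2⟩) ?_ ?_ ?_ ?_
  · rintro ⟨k, l⟩ h _
    simp only [Finset.mem_sigma, Finset.mem_range] at h ⊢
    exact ⟨by omega, by omega⟩
  · rintro ⟨k, l⟩ h _ ⟨k', l'⟩ h' _ e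
    simp only [Finset.mem_sigma, Finset.mem_range, Sigma.mk.injEq, heq_eq_eq] at h h' e ⊢
    omega
  · rintro ⟨l, n⟩ h hne
    simp only [Finset.mem_sigma, Finset.mem_range] at h
    have hlt : l + 1 + n < N := by
      by_contra hge
      rw [hN (l + 1 + n) (by omega), mul_zero, Function.iterate_fixed (by simp)] at hne
      simp at hne
    refine ⟨⟨l + 1 + n, l⟩, by simp only [Finset.mem_sigma, Finset.mem_range]; omega, ?_, ?_⟩
    · simpa [show l + 1 + n - 1 - l = n by omega] using hne
    · simp only [Sigma.mk.injEq, heq_eq_eq, true_and]; omega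
  · rintro ⟨k, l⟩ h _
    simp only [Finset.mem_sigma, Finset.mem_range] at h
    simp only [show l + 1 + (k - 1 - l) = k by omega]

end DiffOp

/-! ### From pseudo-differential operators to polynomial symbols. -/

/-- The Leibniz rule for iterated derivations. -/
theorem Derivation.iterate_leibniz {K : Type*} [CommRing K] [Algebra ℚ K] (d : Derivation ℚ K K)
    (n : ℕ) (f g : K) : d^[n] (f * g) =
      ∑ ij ∈ Finset.HasAntidiagonal.antidiagonal n, (n.choose ij.1 : K) * (d^[ij.1] f * d^[ij.2] g) := by
  induction n with
  | zero => simp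
  | succ n ih =>
    rw [Finset.sum_antidiagonal_choose_succ_mul (fun i j => d^[i] f * d^[j] g),
      Function.iterate_succ_apply', ih, map_sum, ← Finset.sum_add_distrib]
    refine Finset.sum_congr rfl fun ij hij => ?_
    rw [d.leibniz, d.leibniz, d.map_natCast, Function.iterate_succ_apply',
      Function.iterate_succ_apply',
      show n.choose ij.2 = n.choose ij.1 from
        (Nat.choose_symm_of_eq_add (Finset.HasAntidiagonal.mem_antidiagonal.1 hij).symm).symm]
    simp only [smul_eq_mul]; ring

/-- Turns the sum over ℤ × ℕ defining a coefficient of a product into a finite sum, once the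
possibly nonzero terms are parametrized. -/
theorem finsum_eq_sum_of_injOn {ι κ M : Type*} [AddCommMonoid M] (F : κ → M) (s : Finset ι)
    (e : ι → κ) (he : Set.InjOn e s) (h : ∀ y, F y ≠ 0 → ∃ x ∈ s, e x = y) :
    ∑ᶠ y, F y = ∑ x ∈ s, F (e x) := by
  classical
  rw [finsum_eq_sum_of_support_subset F (s := s.image e), Finset.sum_image he]
  intro y hy
  simpa using h y hy

namespace PDO

open Polynomial DiffOp

variable {K : Type*} [CommRing K]

theorem exists_polynomial (A : PDO K) : ∃ p : K[X], ∀ k : ℕ, p.coeff k = A.coeff k := by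
  obtain ⟨N, hN⟩ := A.bdd
  refine ⟨∑ n ∈ Finset.range (N.toNat + 1), monomial n (A.coeff n), fun k => ?_⟩
  simp only [finsetSum_coeff, coeff_monomial, Finset.sum_ite_eq', Finset.mem_range]
  split_ifs with h
  · rfl
  · exact (hN _ (by omega)).symm

/-- The polynomial `∑ aₖ Xᵏ` of the differential part `∑ aₖ Dᵏ` of an operator. -/
noncomputable def symbol (A : PDO K) : K[X] := A.exists_polynomial.choose

@[simp]
theorem coeff_symbol (A : PDO K) (k : ℕ) : A.symbol.coeff k = A.coeff k :=
  A.exists_polynomial.choose_spec k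

theorem coeff_eq_zero_of_natDegree_lt (A : PDO K) (k : ℕ) (hk : A.symbol.natDegree + 1 ≤ k) :
    A.coeff k = 0 := by
  rw [← coeff_symbol, Polynomial.coeff_eq_zero_of_natDegree_lt (by omega)]

theorem coeff_single (n k : ℤ) (f : K) : (single n f).coeff k = if k = n then f else 0 := rfl

variable [Algebra ℚ K] [MultiTime K]

theorem dx_iterate_zero (l : ℕ) : dx^[l] (0 : K) = 0 :=
  Function.iterate_fixed (by simp [dx]) l

theorem dx_iterate_one (l : ℕ) (hl : l ≠ 0) : dx^[l] (1 : K) = 0 := by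
  obtain ⟨l, rfl⟩ := Nat.exists_eq_succ_of_ne_zero hl
  rw [Function.iterate_succ_apply, show dx (1 : K) = 0 by simp [dx], dx_iterate_zero]

theorem applyPos_eq (A : PDO K) (f : K) :
    A.applyPos f = (star (flow 1) A.symbol (C f)).coeff 0 := by
  rw [coeff_zero_star_C _ _ _ (A.symbol.natDegree + 1)
    (fun n hn => Polynomial.coeff_eq_zero_of_natDegree_lt (by omega)), applyPos]
  simp only [coeff_symbol]
  refine finsum_eq_sum_of_support_subset _ fun k hk => ?_
  by_contra hk'
  simp only [Finset.coe_range, Set.mem_Iio] at hk'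
  exact hk (by simp [A.coeff_eq_zero_of_natDegree_lt k (by omega)])

theorem adjApplyPos_eq (A : PDO K) (g : K) : A.adjApplyPos g = adj (flow 1) A.symbol g := by
  rw [adj_eq_sum _ _ _ (A.symbol.natDegree + 1)
    (fun n hn => Polynomial.coeff_eq_zero_of_natDegree_lt (by omega)), adjApplyPos]
  simp only [coeff_symbol]
  refine finsum_eq_sum_of_support_subset _ fun k hk => ?_
  by_contra hk'
  simp only [Finset.coe_range, Set.mem_Iio] at hk'
  exact hk (by simp [A.coeff_eq_zero_of_natDegree_lt k (by omega), dx_iterate_zero])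

theorem coeff_mul (A B : PDO K) (k : ℤ) : (A * B).coeff k = ∑ᶠ p : ℤ × ℕ,
    (Ring.choose p.1 p.2 : ℤ) • (A.coeff p.1 * dx^[p.2] (B.coeff (k - p.1 + p.2))) := rfl

theorem coeff_single_mul_single (n m : ℤ) (f g : K) (l : ℕ) :
    (single n f * single m g).coeff (n + m - l) = Ring.choose n l • (f * dx^[l] g) := by
  rw [coeff_mul, finsum_eq_single _ (n, l)]
  · simp [coeff_single, show n + m - l - n + l = m by ring]
  · rintro ⟨p, q⟩ hne
    by_cases hp : p = n
    · subst hp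
      have : p + m - l - p + q ≠ m := fun h => hne (by
        simp only [Prod.mk.injEq, true_and]; omega)
      simp [coeff_single, this, dx_iterate_zero]
    · simp [coeff_single, hp]

theorem coeff_single_mul_single_of_lt (n m k : ℤ) (f g : K) (hk : n + m < k) :
    (single n f * single m g).coeff k = 0 := by
  refine finsum_eq_zero_of_forall_eq_zero fun p => ?_
  by_cases hp : p.1 = n
  · have : k - p.1 + p.2 ≠ m := by omega
    simp [coeff_single, this, dx_iterate_zero]
  · simp [coeff_single, hp]

theorem single_mul_D (n m : ℤ) (f : K) : single n f * D m = single (n + m) f := by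
  ext k
  rcases lt_or_ge (n + m) k with h | h
  · rw [D, coeff_single_mul_single_of_lt _ _ _ _ _ h, coeff_single, if_neg h.ne']
  · obtain ⟨l, hl⟩ := Int.eq_ofNat_of_zero_le (sub_nonneg.2 h)
    obtain rfl : k = n + m - l := by omega
    rw [D, coeff_single_mul_single, coeff_single]
    rcases Nat.eq_zero_or_pos l with rfl | h0
    · simp
    · rw [dx_iterate_one l h0.ne', if_neg (by omega)]; simp

/-- The coefficients of `f D g`. -/
theorem coeff_func_mul_D_mul_func (f g : K) (k : ℤ) :
    (func f * D 1 * func g).coeff k =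
      if k = 1 then f * g else if k = 0 then f * dx g else 0 := by
  rw [func, single_mul_D, func, zero_add]
  rcases lt_or_ge 1 k with h | h
  · rw [coeff_single_mul_single_of_lt _ _ _ _ _ (by omega), if_neg (by omega), if_neg (by omega)]
  · obtain ⟨l, hl⟩ := Int.eq_ofNat_of_zero_le (sub_nonneg.2 h)
    obtain rfl : k = 1 + 0 - l := by omega
    rw [coeff_single_mul_single, show (1 : ℤ) = ((1 : ℕ) : ℤ) by rfl, Ring.choose_natCast]
    match l with
    | 0 => simp
    | 1 => simp
    | l + 2 =>
      rw [Nat.choose_eq_zero_of_lt (by omega), if_neg (by omega), if_neg (by omega)]; simp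

/-- The coefficients of `D⁻¹ g`. -/
theorem coeff_D_mul_func (g : K) (i : ℕ) :
    (D (-1) * func g).coeff (-1 - i) = (-1) ^ i * dx^[i] g := by
  have := coeff_single_mul_single (-1) 0 (1 : K) g i
  rw [add_zero] at this
  rw [D, func, this, one_mul, Ring.choose_neg,
    show (1 : ℤ) + i - 1 = ((i : ℕ) : ℤ) by ring, Ring.choose_natCast]
  simp [Int.negOnePow, Units.smul_def]

theorem coeff_D_mul_func_of_nonneg (g : K) (k : ℤ) (hk : 0 ≤ k) :
    (D (-1) * func g).coeff k = 0 :=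
  coeff_single_mul_single_of_lt _ _ _ _ _ (by omega)

theorem coeff_mul_D (A : PDO K) (m k : ℤ) : (A * D m).coeff k = A.coeff (k - m) := by
  rw [coeff_mul, finsum_eq_single _ (k - m, 0)]
  · simp [D, coeff_single]
  · rintro ⟨p, q⟩ hne
    by_cases hq : q = 0
    · subst hq
      have : k - p + (0 : ℕ) ≠ m := fun h => hne (by
        simp only [Prod.mk.injEq, and_true]; omega)
      simp only [D, coeff_single, this, if_false, dx_iterate_zero, mul_zero, smul_zero]
    · simp only [D, coeff_single]
      split_ifs
      · rw [dx_iterate_one q hq, mul_zero, smul_zero]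
      · rw [dx_iterate_zero, mul_zero, smul_zero]

theorem coeff_zero_mul_func (A : PDO K) (f : K) (N : ℕ) (hN : ∀ n : ℕ, N ≤ n → A.coeff n = 0) :
    (A * func f).coeff 0 = ∑ l ∈ Finset.range N, A.coeff l * dx^[l] f := by
  rw [coeff_mul, finsum_eq_sum_of_injOn _ (Finset.range N) (fun l => ((l : ℤ), l))]
  · refine Finset.sum_congr rfl fun l _ => ?_
    simp [func, coeff_single, Ring.choose_natCast]
  · intro l _ l' _ h
    exact (Prod.mk.inj h).2
  · rintro ⟨p, q⟩ hne
    have hp : p = q := by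
      by_contra hpq
      have : 0 - p + (q : ℤ) ≠ 0 := by omega
      simp only [func, coeff_single, this, if_false, dx_iterate_zero, mul_zero, smul_zero] at hne
      exact hne rfl
    subst hp
    refine ⟨q, ?_, rfl⟩
    by_contra hq
    rw [Finset.mem_range, not_lt] at hq
    simp [hN q hq] at hne

/-- The coefficients of `(D⁻¹ g) A₊`. -/
theorem coeff_D_mul_func_mul_pos (A : PDO K) (g : K) (N : ℕ)
    (hN : ∀ n : ℕ, N ≤ n → A.coeff n = 0) (l : ℕ) :
    (D (-1) * func g * A.pos).coeff l =
      ∑ n ∈ Finset.range N, (-1) ^ n * dx^[n] (g * A.coeff (l + 1 + n : ℕ)) := by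
  have hpos : ∀ k : ℕ, A.pos.coeff k = A.coeff k := fun k => by
    simp [PDO.pos]
  -- The coefficient of D^(−1−i) in D⁻¹ g carries ∂ⁱg, and moving D^(−1−i) past a coefficient can
  -- differentiate it q times. As (−1−i choose q) = (−1)^q (i+q choose q), the terms with i + q = n
  -- add up to (−1)ⁿ ∂ⁿ of a product.
  rw [coeff_mul, finsum_eq_sum_of_injOn _ ((Finset.range N).sigma Finset.HasAntidiagonal.antidiagonal)
    (fun x => (-1 - (x.2.1 : ℤ), x.2.2)), Finset.sum_sigma]
  · refine Finset.sum_congr rfl fun n _ => ?_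
    have := (flow 1 : Derivation ℚ K K).iterate_leibniz n g (A.coeff (l + 1 + n : ℕ))
    rw [show dx^[n] (g * A.coeff (l + 1 + n : ℕ)) = _ from this, Finset.mul_sum]
    refine Finset.sum_congr rfl fun ij hij => ?_
    rw [Finset.HasAntidiagonal.mem_antidiagonal] at hij
    simp only
    rw [coeff_D_mul_func, show (l : ℤ) - (-1 - (ij.1 : ℤ)) + ij.2 = ((l + 1 + n : ℕ) : ℤ) by omega,
      hpos, show (-1 - (ij.1 : ℤ)) = -((ij.1 + 1 : ℕ) : ℤ) by push_cast; ring, Ring.choose_neg,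
      show ((ij.1 + 1 : ℕ) : ℤ) + ij.2 - 1 = ((n : ℕ) : ℤ) by omega, Ring.choose_natCast,
      ← Nat.choose_symm_of_eq_add (show n = ij.1 + ij.2 from hij.symm)]
    have e : Int.negOnePow (ij.2 : ℤ) • ((n.choose ij.1 : ℕ) : ℤ) =
        (-1) ^ ij.2 * (n.choose ij.1 : ℤ) := by
      simp [Int.negOnePow, Units.smul_def]
    rw [e, zsmul_eq_mul, ← hij, pow_add]
    push_cast
    change _ = _ * (_ * (dx^[ij.1] g * dx^[ij.2] _))
    ring
  · rintro ⟨n, i, q⟩ h ⟨n', i', q'⟩ h' e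
    simp only [Finset.coe_sigma, Set.mem_sigma_iff, Finset.mem_coe, Finset.HasAntidiagonal.mem_antidiagonal]
      at h h'
    simp only [Prod.mk.injEq] at e
    obtain rfl : i = i' := by omega
    obtain rfl : q = q' := by omega
    obtain rfl : n = n' := by omega
    rfl
  · rintro ⟨p, q⟩ hne
    have hp : p < 0 := by
      by_contra hp
      simp [coeff_D_mul_func_of_nonneg g p (by omega)] at hne
    obtain ⟨i, rfl⟩ : ∃ i : ℕ, p = -1 - i := ⟨(-1 - p).toNat, by omega⟩
    refine ⟨⟨i + q, i, q⟩, ?_, rfl⟩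
    simp only [Finset.mem_sigma, Finset.HasAntidiagonal.mem_antidiagonal, and_true, Finset.mem_range]
    by_contra hge
    simp only at hne
    rw [show (l : ℤ) - (-1 - i) + q = ((l + 1 + i + q : ℕ) : ℤ) by push_cast; ring, hpos,
      hN _ (by omega), dx_iterate_zero] at hne
    simp at hne

/-- `Res (D⁻¹ g A₊ f D⁻¹)` is the bilinear concomitant. -/
theorem res_eq_concomitant (A : PDO K) (g f : K) :
    (D (-1) * func g * A.pos * func f * D (-1)).res =
      concomitant (flow 1) A.symbol g f := by
  set N := A.symbol.natDegree + 1 with hNdef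
  have hN : ∀ n : ℕ, N ≤ n → A.coeff n = 0 := A.coeff_eq_zero_of_natDegree_lt
  -- The final D⁻¹ turns the residue into the coefficient of D⁰, to which only the nonnegative
  -- orders of D⁻¹ g A₊ contribute.
  rw [concomitant_eq_sum _ _ _ _ N (fun n hn => by rw [coeff_symbol, hN n hn]), res, coeff_mul_D,
    show (-1 : ℤ) - -1 = 0 by ring, coeff_zero_mul_func _ _ N]
  · refine Finset.sum_congr rfl fun l _ => ?_
    rw [coeff_D_mul_func_mul_pos A g N hN]
    simp only [coeff_symbol]
    rfl
  · intro n hn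
    rw [coeff_D_mul_func_mul_pos A g N hN]
    refine Finset.sum_eq_zero fun k _ => ?_
    rw [hN _ (by omega), mul_zero, dx_iterate_zero, mul_zero]

/-- Multiplication by an operator `t D + s` with constant `t` from the left. -/
theorem coeff_orderOne_mul {T : PDO K} (hT : ∀ k : ℤ, k ≠ 0 → k ≠ 1 → T.coeff k = 0)
    (A : PDO K) (k : ℤ) :
    (T * A).coeff k = T.coeff 1 * (A.coeff (k - 1) + dx (A.coeff k)) + T.coeff 0 * A.coeff k := by
  rw [coeff_mul, finsum_eq_sum_of_support_subset _ (s := {(1, 0), (1, 1), (0, 0)})]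
  · rw [Finset.sum_insert (by simp), Finset.sum_insert (by simp), Finset.sum_singleton]
    simp
    ring
  · rintro ⟨p, q⟩ hne
    rw [Function.mem_support] at hne
    by_cases h0 : p = 0
    · subst h0
      cases q with
      | zero => simp
      | succ q => simp [Ring.choose_zero_succ] at hne
    · by_cases h1 : p = 1
      · subst h1
        match q with
        | 0 => simp
        | 1 => simp
        | q + 2 =>
          simp only at hne
          rw [show (1 : ℤ) = ((1 : ℕ) : ℤ) by rfl, Ring.choose_natCast,
            Nat.choose_eq_zero_of_lt (by omega)] at hne
          simp at hne
      · simp [hT p h0 h1] at hne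

/-- Multiplication by an operator `t D + s` with constant `t` from the right. -/
theorem coeff_mul_orderOne {T : PDO K} (hT : ∀ k : ℤ, k ≠ 0 → k ≠ 1 → T.coeff k = 0)
    (h1 : dx (T.coeff 1) = 0) (A : PDO K) (k : ℕ) :
    (A * T).coeff (k + 1 : ℕ) = A.coeff k * T.coeff 1 +
      (star (flow 1) A.symbol (C (T.coeff 0))).coeff (k + 1) := by
  set N := A.symbol.natDegree + 1 with hNdef
  have hN : ∀ n : ℕ, N ≤ n → A.coeff n = 0 := A.coeff_eq_zero_of_natDegree_lt
  have hd : ∀ q : ℕ, q ≠ 0 → dx^[q] (T.coeff 1) = 0 := by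
    intro q hq
    obtain ⟨q, rfl⟩ := Nat.exists_eq_succ_of_ne_zero hq
    rw [Function.iterate_succ_apply, h1, dx_iterate_zero]
  -- `none` is the pair (k, 0), where the constant leading coefficient of T enters undifferentiated;
  -- `some l` is the l-th derivative of its order-zero coefficient.
  rw [coeff_star_C _ _ _ _ N (fun n hn => by rw [coeff_symbol, hN n hn]), coeff_mul,
    finsum_eq_sum_of_injOn _ (Finset.insertNone (Finset.range N)) (fun o => o.elim ((k : ℤ), 0)
      fun l => ((k + 1 + l : ℕ), l)), Finset.sum_insertNone]
  · congr 1
    · simp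
    · refine Finset.sum_congr rfl fun l _ => ?_
      simp only [Option.elim, coeff_symbol]
      rw [Ring.choose_natCast, show ((k + 1 : ℕ) : ℤ) - ((k + 1 + l : ℕ) : ℤ) + l = 0 by
        push_cast; ring]
      simp
      rfl
  · rintro (_ | l) _ (_ | l') _ e
    · rfl
    · simp at e; omega
    · simp at e; omega
    · simp only [Option.elim, Prod.mk.injEq] at e; rw [e.2]
  · rintro ⟨p, q⟩ hne
    by_cases e1 : ((k + 1 : ℕ) : ℤ) - p + q = 1
    · by_cases hq : q = 0
      · refine ⟨none, by simp, ?_⟩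
        subst hq
        simp only [Option.elim, Prod.mk.injEq, and_true]
        push_cast at e1
        omega
      · simp only [e1, hd q hq, mul_zero, smul_zero] at hne
        exact absurd rfl hne
    · by_cases e0 : ((k + 1 : ℕ) : ℤ) - p + q = 0
      · obtain rfl : p = ((k + 1 + q : ℕ) : ℤ) := by push_cast at e0 ⊢; omega
        refine ⟨some q, ?_, rfl⟩
        rw [Finset.some_mem_insertNone, Finset.mem_range]
        by_contra hq
        simp only [hN (k + 1 + q) (by omega), zero_mul, smul_zero] at hne
        exact hne rfl
      · simp only [hT _ e0 e1, dx_iterate_zero, mul_zero, smul_zero] at hne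
        exact absurd rfl hne

end PDO

/-! ### Quotient rules and conjugation of the differential parts. -/

section BinaryStep

open Polynomial DiffOp

variable {K : Type*} [CommRing K] [Algebra ℚ K]

theorem DiffOp.star_one (d : Derivation ℚ K K) (p : K[X]) : star d p 1 = p := by
  induction p using Polynomial.induction_on' with
  | add p q hp hq => simp [hp, hq]
  | monomial n a =>
    induction n with
    | zero => rw [monomial_zero_left, star_C, mul_one]
    | succ n ih =>
      have h : shift d 1 = 1 * X := by
        rw [shift_apply, ← C_1, coeffDeriv_C, d.map_one_eq_zero]; simp
      rw [← monomial_mul_X, mul_X_star, h, star_mul_X, ih]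

theorem Derivation.map_eq_of_mul_eq_one (d : Derivation ℚ K K) {f g : K} (h : f * g = 1) :
    d f = -(f * d g) * f := by
  have h0 : d (f * g) = 0 := by rw [h, d.map_one_eq_zero]
  rw [d.leibniz, smul_eq_mul, smul_eq_mul] at h0
  linear_combination f * h0 - d f * h

/-- The logarithmic form of the quotient rule: `p ∂(s / p)` for `p = q S₀`, `s = q S₁`
with `q` invertible. -/
theorem mul_deriv_quotient (d : Derivation ℚ K K) {q q' S₀ S₀' S₁ p' : K} (hq : q * q' = 1)
    (hS : S₀ * S₀' = 1) (hp : q * S₀ * p' = 1) :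
    q * S₀ * d (q * S₁ * p') = q * (d S₁ - d S₀ * S₀' * S₁) := by
  have hp' : p' = q' * S₀' := by
    linear_combination q' * S₀' * hp - p' * q * q' * hS - p' * hq
  have h1 : q * S₁ * p' = S₁ * S₀' := by rw [hp']; linear_combination S₁ * S₀' * hq
  have h2 := d.map_eq_of_mul_eq_one ((mul_comm S₀' S₀).trans hS)
  rw [h1, d.leibniz, smul_eq_mul, smul_eq_mul, h2]
  linear_combination (q * d S₁ - q * S₁ * d S₀ * S₀') * hS

variable [MultiTime K]

/-- Conjugation by `D - v` restricted to the differential parts. -/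
theorem PDO.exists_star_symbol_eq {A B T : PDO K}
    (hT : ∀ k : ℤ, k ≠ 0 → k ≠ 1 → T.coeff k = 0) {u w : K} (hu : flow 1 u = 0)
    (h1 : T.coeff 1 = u) (h0 : T.coeff 0 = u * w) (hu' : IsUnit u) (h : B * T = T * A) :
    ∃ c : K, star (flow 1) B.symbol (X + C w) = star (flow 1) (X + C w) A.symbol - C c := by
  -- With T = u(D + w), the negative parts of A and B enter T A and B T only at orders ≤ 0. The
  -- positive orders therefore agree, and c is the discrepancy at order zero.
  refine ⟨(star (flow 1) (X + C w) A.symbol - star (flow 1) B.symbol (X + C w)).coeff 0, ?_⟩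
  have hu1 : star (flow 1) B.symbol (C (u * w)) = C u * star (flow 1) B.symbol (C w) := by
    induction B.symbol using Polynomial.induction_on' with
    | add p q hp hq => simp only [map_add, LinearMap.add_apply, hp, hq, mul_add]
    | monomial n a =>
      rw [star_monomial, star_monomial]
      have : ∀ q : K[X], (shift (flow 1) ^ n) (C u * q) = C u * (shift (flow 1) ^ n) q := by
        induction n with
        | zero => simp
        | succ n ih =>
          intro q
          rw [pow_succ, Module.End.mul_apply, Module.End.mul_apply, shift_C_mul, hu, C_0, zero_mul,
            add_zero, ih]
      rw [C_mul, this]; ring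
  ext k
  cases k with
  | zero => simp
  | succ k =>
    have e : (B * T).coeff ((k + 1 : ℕ) : ℤ) = (T * A).coeff ((k + 1 : ℕ) : ℤ) := by rw [h]
    rw [coeff_orderOne_mul hT, coeff_mul_orderOne hT (by rw [h1]; exact hu), h1, h0, hu1,
      coeff_C_mul, show ((k + 1 : ℕ) : ℤ) - 1 = k by push_cast; ring] at e
    have e3 : star (flow 1) B.symbol X = B.symbol * X := by
      conv_lhs => rw [← one_mul X, star_mul_X, DiffOp.star_one]
    rw [map_add, e3, map_add (star (flow 1)), LinearMap.add_apply, star_X, star_C, shift_apply]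
    simp only [coeff_add, coeff_sub, coeff_mul_X, coeff_X_mul, coeff_C_mul, coeff_C_succ,
      coeff_coeffDeriv, coeff_symbol]
    refine hu'.mul_left_cancel ?_
    change _ = u * (A.coeff k + dx _ + _ - _)
    linear_combination e

variable {m : ℕ} {r : ℕ+} {X Y Z : LaxData K m} {a b : Fin m}

/-! ### Iterated eigenfunctions under the two transformations. -/

namespace IsCKP

theorem flow_r_sep (hX : IsCKP r X) (c : Fin m) (i : ℕ) (d : Fin m) (j : ℕ) :
    flow r (X.S c i d j) =
      concomitant (flow 1) X.L.symbol (X.psi d j) (X.phi c i) := by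
  rw [hX.sep, PDO.res_eq_concomitant, hX.root_pow]

theorem dx_sep (hX : IsCKP r X) (c : Fin m) (i : ℕ) (d : Fin m) (j : ℕ) :
    flow 1 (X.S c i d j) = X.phi c i * X.psi d j := by
  -- The first power unfolds to `D 0 * X.root`, whose coefficients are computed directly.
  have hroot : ∀ k : ℤ, (X.root ^ ((1 : ℕ+) : ℕ)).coeff k = X.root.coeff k := by
    intro k
    change (PDO.D 0 * X.root).coeff k = _
    rw [PDO.coeff_orderOne_mul (fun k h _ => by simp [PDO.D, PDO.coeff_single, h])]
    simp [PDO.D, PDO.coeff_single]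
  have h1 : (X.root ^ ((1 : ℕ+) : ℕ)).symbol.coeff 1 = 1 := by
    rw [PDO.coeff_symbol, hroot, Nat.cast_one, hX.root_monic]
  have h2 : ∀ n, 2 ≤ n → (X.root ^ ((1 : ℕ+) : ℕ)).symbol.coeff n = 0 := fun n hn => by
    rw [PDO.coeff_symbol, hroot, hX.root_order _ (by omega)]
  -- The concomitant does not see the order-zero coefficient, so only the leading D of the root
  -- matters.
  rw [hX.sep, PDO.res_eq_concomitant, concomitant_eq_sum _ _ _ _ 2 h2]
  generalize (X.root ^ ((1 : ℕ+) : ℕ)).symbol = p at h1 h2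
  simp [Finset.sum_range_succ, h1, h2, mul_comm]

end IsCKP

namespace IsDB

theorem mul_inverse (h : IsDB r a X Y) : X.phi a 0 * Ring.inverse (X.phi a 0) = 1 :=
  Ring.mul_inverse_cancel _ h.unit

/-- `T(L^i(f)) = L̃^i(T(f))`. -/
theorem phi_eq (h : IsDB r a X Y) (c : Fin m) (i : ℕ) :
    Y.phi c i = X.phi a 0 * flow 1
      (X.phi c (if c = a then i + 1 else i) * Ring.inverse (X.phi a 0)) := by
  -- The potentials against 1/Φ_a are prescribed for every i; differentiating them gives all
  -- iterates at once, without induction.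
  rw [← h.sep_self, h.ckp.dx_sep, h.psi_self]
  linear_combination -Y.phi c i * h.mul_inverse

/-- `(T*)⁻¹((L*)^j(g)) = (L̃*)^j((T*)⁻¹(g))`. -/
theorem psi_eq (hX : IsCKP r X) (h : IsDB r a X Y) {d : Fin m} (hd : d ≠ a) (j : ℕ) :
    Y.psi d j = -(Ring.inverse (X.phi a 0) * X.S a 0 d j) := by
  induction j with
  | zero => exact h.psi_ne d hd
  | succ j ih =>
    have hinv := h.mul_inverse
    set Φ := X.phi a 0 with hΦ
    set Φ' := Ring.inverse (X.phi a 0) with hΦ'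
    -- Φ D Φ⁻¹ = D + Φ ∂(Φ⁻¹).
    obtain ⟨c, hc⟩ := PDO.exists_star_symbol_eq (u := 1) (w := Φ * flow 1 Φ')
      (fun k h0 h1 => by rw [PDO.coeff_func_mul_D_mul_func, if_neg h1, if_neg h0])
      (flow 1).map_one_eq_zero
      (by rw [PDO.coeff_func_mul_D_mul_func, if_pos rfl, hinv])
      (by rw [PDO.coeff_func_mul_D_mul_func, one_mul]; rfl)
      isUnit_one h.lax
    have hc' : star (flow 1) Y.L.symbol (Polynomial.X - C (-(Φ * flow 1 Φ'))) =
        star (flow 1) (Polynomial.X - C (-(Φ * flow 1 Φ'))) X.L.symbol - C c := by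
      rw [C_neg, sub_neg_eq_add, hc]
    have key := adj_darboux (flow 1) (S := X.S a 0 d j) hinv
      ((flow 1).map_eq_of_mul_eq_one hinv) hc'
    have hpsi : Φ' * flow 1 (X.S a 0 d j) = X.psi d j := by
      rw [hX.dx_sep]; linear_combination X.psi d j * hinv
    rw [hpsi, ← hX.flow_r_sep, hX.sep_norm, ← PDO.applyPos_eq, zero_add] at key
    have hsum : ∑ c, Y.psi c 0 * Y.S c 0 d j =
        Φ' * (X.S a 1 d j - X.phi a 1 * Φ' * X.S a 0 d j)
        - Φ' * ∑ c, X.S a 0 c 0 * X.S c 0 d j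
        + Φ' * Φ' * X.S a 0 d j * ∑ c, X.phi c 0 * X.S a 0 c 0 := by
      -- The expression valid for c ≠ a vanishes at c = a because ΦΦ⁻¹ = 1. Hence it may be summed
      -- over all c, the genuine a-term being added separately.
      have hterm : ∀ c, Y.psi c 0 * Y.S c 0 d j =
          (if c = a then Φ' * (X.S a 1 d j - X.phi a 1 * Φ' * X.S a 0 d j) else 0)
          - Φ' * (X.S a 0 c 0 * X.S c 0 d j)
          + Φ' * Φ' * X.S a 0 d j * (X.phi c 0 * X.S a 0 c 0) := by
        intro c
        by_cases hca : c = a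
        · subst hca
          rw [h.sep_ne _ _ _ _ hd, h.psi_self, if_pos rfl, if_pos rfl, zero_add]
          linear_combination -Φ' * X.S c 0 c 0 * X.S c 0 d j * hinv
        · rw [h.sep_ne _ _ _ _ hd, h.psi_ne c hca, if_neg hca, if_neg hca]
          ring
      simp only [hterm, Finset.sum_add_distrib, Finset.sum_sub_distrib, ← Finset.mul_sum,
        Finset.sum_ite_eq', Finset.mem_univ, if_true]
    rw [h.ckp.psi_succ, PDO.adjApplyPos_eq, ih, key, hsum, hX.phi_succ a 0]
    ring

end IsDB

namespace IsAdjDB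

theorem mul_inverse (h : IsAdjDB r b X Y) : X.psi b 0 * Ring.inverse (X.psi b 0) = 1 :=
  Ring.mul_inverse_cancel _ h.unit

/-- `T((L*)^j(g)) = (L̄*)^j(T(g))`. -/
theorem psi_eq (h : IsAdjDB r b X Y) (d : Fin m) (j : ℕ) :
    Y.psi d j = X.psi b 0 * flow 1
      (X.psi d (if d = b then j + 1 else j) * Ring.inverse (X.psi b 0)) := by
  have := h.ckp.dx_sep b 0 d j
  rw [h.sep_self, h.phi_self, map_neg] at this
  linear_combination -Y.psi d j * h.mul_inverse + X.psi b 0 * this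

/-- `(T*)⁻¹(L^i(f)) = L̄^i((T*)⁻¹(f))`. -/
theorem phi_eq (hX : IsCKP r X) (h : IsAdjDB r b X Y) {c : Fin m} (hc : c ≠ b) (i : ℕ) :
    Y.phi c i = -(Ring.inverse (X.psi b 0) * X.S c i b 0) := by
  induction i with
  | zero => exact h.phi_ne c hc
  | succ i ih =>
    have hinv := h.mul_inverse
    set Ψ := X.psi b 0 with hΨ
    set Ψ' := Ring.inverse (X.psi b 0) with hΨ'
    -- −Ψ⁻¹ D Ψ = −(D + Ψ⁻¹ ∂Ψ). The relation is read backwards: here the old operator stands to the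
    -- left of T*.
    obtain ⟨e, he⟩ := PDO.exists_star_symbol_eq (u := -1) (w := Ψ' * flow 1 Ψ)
      (fun k h0 h1 => by rw [PDO.coeff_func_mul_D_mul_func, if_neg h1, if_neg h0])
      (by rw [map_neg, (flow 1).map_one_eq_zero, neg_zero])
      (by rw [PDO.coeff_func_mul_D_mul_func, if_pos rfl]; linear_combination -hinv)
      (by rw [PDO.coeff_func_mul_D_mul_func, if_neg (by norm_num), if_pos rfl, dx]; ring)
      isUnit_one.neg h.lax.symm
    have key := apply_adj_darboux (flow 1) (S := X.S c i b 0) (w := Ψ' * flow 1 Ψ) (c := e) hinv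
      (by linear_combination -flow 1 Ψ * hinv) (by rw [he, sub_add_cancel])
    have hphi : Ψ' * flow 1 (X.S c i b 0) = X.phi c i := by
      rw [hX.dx_sep]; linear_combination X.phi c i * hinv
    rw [hphi, ← hX.flow_r_sep, hX.sep_norm, ← PDO.applyPos_eq, ← PDO.adjApplyPos_eq,
      zero_add] at key
    have hsum : ∑ d, Y.phi d 0 * Y.S c i d 0 =
        -(Ψ' * (X.S c i b 1 - X.psi b 1 * Ψ' * X.S c i b 0))
        - Ψ' * ∑ d, X.S c i d 0 * X.S d 0 b 0
        + Ψ' * Ψ' * X.S c i b 0 * ∑ d, X.psi d 0 * X.S d 0 b 0 := by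
      have hterm : ∀ d, Y.phi d 0 * Y.S c i d 0 =
          (if d = b then -(Ψ' * (X.S c i b 1 - X.psi b 1 * Ψ' * X.S c i b 0)) else 0)
          - Ψ' * (X.S c i d 0 * X.S d 0 b 0)
          + Ψ' * Ψ' * X.S c i b 0 * (X.psi d 0 * X.S d 0 b 0) := by
        intro d
        by_cases hdb : d = b
        · subst hdb
          rw [h.sep_ne _ _ _ _ hc, h.phi_self, if_pos rfl, if_pos rfl, zero_add]
          linear_combination -Ψ' * X.S d 0 d 0 * X.S c i d 0 * hinv
        · rw [h.sep_ne _ _ _ _ hc, h.phi_ne d hdb, if_neg hdb, if_neg hdb]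
          ring
      simp only [hterm, Finset.sum_add_distrib, Finset.sum_sub_distrib, ← Finset.mul_sum,
        Finset.sum_ite_eq', Finset.mem_univ, if_true]
    rw [h.ckp.phi_succ, ih, key, hsum, hX.psi_succ b 0]
    ring

end IsAdjDB

/-! ### A binary step as a Schur complement. -/

/-- The effect of a binary step: Schur complements with respect to `S(Φ_a, Ψ_b)`. -/
structure IsSchurStep (a b : Fin m) (X Z : LaxData K m) : Prop where
  unit : IsUnit (X.S a 0 b 0)
  sep : ∀ i j, Z.S a i b j = X.S a (i + 1) b (j + 1)
    - X.S a (i + 1) b 0 * Ring.inverse (X.S a 0 b 0) * X.S a 0 b (j + 1)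
  phi : ∀ i, Z.phi a i = -(X.phi a (i + 1)
    - X.S a (i + 1) b 0 * Ring.inverse (X.S a 0 b 0) * X.phi a 0)
  psi : ∀ j, Z.psi b j = -(X.psi b (j + 1)
    - X.psi b 0 * Ring.inverse (X.S a 0 b 0) * X.S a 0 b (j + 1))
  tau : Z.tau = -(X.S a 0 b 0) * X.tau

theorem IsBinaryDB.isCKP (h : IsBinaryDB r a b X Z) : IsCKP r Z := by
  obtain ⟨Y, ⟨_, h⟩ | ⟨_, h⟩⟩ := h
  exacts [h.ckp, h.ckp]

/-- The first transformation turns the function used by the second into −S_{00}/Φ_a or −S_{00}/Ψ_b,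
so its invertibility is that of S_{00}. Substituting one set of formulas into the other cancels all
quotients by Φ_a or Ψ_b, which is why both orders give the same result. The DB part shifts i and the
adjoint part shifts j; a ≠ b makes the formulas for the other index apply. -/
theorem IsBinaryDB.isSchurStep (hab : a ≠ b) (hX : IsCKP r X) (h : IsBinaryDB r a b X Z) :
    IsSchurStep a b X Z := by
  obtain ⟨Y, ⟨h1, h2⟩ | ⟨h1, h2⟩⟩ := h
  · have hinv := h1.mul_inverse
    have hinv2 := h2.mul_inverse
    have hpsi := fun j => h1.psi_eq hX hab.symm j
    set Φ := X.phi a 0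
    set Φ' := Ring.inverse Φ
    have hu : IsUnit (X.S a 0 b 0) := by
      have := h2.unit
      rw [hpsi, IsUnit.neg_iff] at this
      exact isUnit_of_mul_isUnit_right this
    have hS := Ring.mul_inverse_cancel _ hu
    set S' := Ring.inverse (X.S a 0 b 0)
    set p' := Ring.inverse (Y.psi b 0)
    have hp : p' = -(Φ * S') := by
      rw [hpsi] at hinv2
      linear_combination -Φ * S' * hinv2 - Φ * Φ' * p' * hS - p' * hinv
    refine ⟨hu, fun i j => ?_, fun i => ?_, fun j => ?_, ?_⟩
    · rw [h2.sep_ne _ _ _ _ hab, if_pos rfl, h1.sep_ne _ _ _ _ hab.symm,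
        h1.sep_ne _ _ _ _ hab.symm, if_pos rfl, hpsi]
      change _ - _ * p' * _ = _
      rw [hp]
      linear_combination X.S a 0 b (j + 1) * (X.phi a (i + 1) * Φ' * X.S a 0 b 0 * S' -
        X.S a (i + 1) b 0 * S') * hinv + X.S a 0 b (j + 1) * X.phi a (i + 1) * Φ' * hS
    · rw [h2.phi_eq h1.ckp hab, h1.sep_ne _ _ _ _ hab.symm, if_pos rfl]
      change -(p' * _) = _
      rw [hp]
      linear_combination -X.phi a (i + 1) * (X.S a 0 b 0 * S' * hinv + hS)
    -- Both functions in the quotient carry the factor −1/Φ_a, which drops out; then ∂S_{0j} = Φ_a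
    -- χ*_j.
    · have := mul_deriv_quotient (flow 1) (q := -Φ') (q' := -Φ) (S₁ := X.S a 0 b (j + 1))
        (p' := p') (by linear_combination hinv) hS (by rw [hpsi] at hinv2; linear_combination hinv2)
      have h3 := h2.psi_eq b j
      rw [if_pos rfl] at h3
      change _ = Y.psi b 0 * flow 1 (Y.psi b (j + 1) * p') at h3
      rw [h3, hpsi (j + 1), hpsi 0, ← neg_mul, ← neg_mul, this, hX.dx_sep, hX.dx_sep]
      linear_combination -(X.psi b (j + 1) - X.psi b 0 * S' * X.S a 0 b (j + 1)) * hinv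
    · rw [h2.tau, h1.tau, hpsi]
      linear_combination -X.S a 0 b 0 * X.tau * hinv
  -- The mirror image, with Φ_a and Ψ_b interchanged.
  · have hinv := h1.mul_inverse
    have hinv2 := h2.mul_inverse
    have hphi := fun i => h1.phi_eq hX hab i
    set Ψ := X.psi b 0
    set Ψ' := Ring.inverse Ψ
    have hu : IsUnit (X.S a 0 b 0) := by
      have := h2.unit
      rw [hphi, IsUnit.neg_iff] at this
      exact isUnit_of_mul_isUnit_right this
    have hS := Ring.mul_inverse_cancel _ hu
    set S' := Ring.inverse (X.S a 0 b 0)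
    set p' := Ring.inverse (Y.phi a 0)
    have hp : p' = -(Ψ * S') := by
      rw [hphi] at hinv2
      linear_combination -Ψ * S' * hinv2 - Ψ * Ψ' * p' * hS - p' * hinv
    refine ⟨hu, fun i j => ?_, fun i => ?_, fun j => ?_, ?_⟩
    · rw [h2.sep_ne _ _ _ _ hab.symm, if_pos rfl, h1.sep_ne _ _ _ _ hab,
        h1.sep_ne _ _ _ _ hab, if_pos rfl, hphi]
      change _ - _ * p' * _ = _
      rw [hp]
      linear_combination X.S a (i + 1) b 0 * (X.psi b (j + 1) * Ψ' * X.S a 0 b 0 * S' -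
        X.S a 0 b (j + 1) * S') * hinv + X.S a (i + 1) b 0 * X.psi b (j + 1) * Ψ' * hS
    · have := mul_deriv_quotient (flow 1) (q := -Ψ') (q' := -Ψ) (S₁ := X.S a (i + 1) b 0)
        (p' := p') (by linear_combination hinv) hS (by rw [hphi] at hinv2; linear_combination hinv2)
      have h3 := h2.phi_eq a i
      rw [if_pos rfl] at h3
      change _ = Y.phi a 0 * flow 1 (Y.phi a (i + 1) * p') at h3
      rw [h3, hphi (i + 1), hphi 0, ← neg_mul, ← neg_mul, this, hX.dx_sep, hX.dx_sep]
      linear_combination -(X.phi a (i + 1) - X.S a (i + 1) b 0 * S' * X.phi a 0) * hinv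
    · rw [h2.psi_eq h1.ckp hab.symm, h1.sep_ne _ _ _ _ hab, if_pos rfl]
      change -(p' * _) = _
      rw [hp]
      linear_combination -X.psi b (j + 1) * (X.S a 0 b 0 * S' * hinv + hS)
    · rw [h2.tau, h1.tau, hphi]
      linear_combination -X.S a 0 b 0 * X.tau * hinv

end BinaryStep

/-! ### Determinants and induction on the number of steps. -/

section SchurInduction

open Matrix

/-- The determinant through the Schur complement of an invertible entry. -/
theorem Matrix.det_eq_mul_det_schur {R ι κ : Type*} [CommRing R] [Fintype ι] [DecidableEq ι]
    [Fintype κ] [DecidableEq κ] (e : Unit ⊕ ι ≃ κ) (M : Matrix κ κ R)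
    (hu : IsUnit (M (e (.inl ())) (e (.inl ())))) :
    M.det = M (e (.inl ())) (e (.inl ())) * (Matrix.of fun i j =>
      M (e (.inr i)) (e (.inr j)) - M (e (.inr i)) (e (.inl ())) *
        Ring.inverse (M (e (.inl ())) (e (.inl ()))) * M (e (.inl ())) (e (.inr j))).det := by
  set x := M (e (.inl ())) (e (.inl ())) with hx
  have hinv := Ring.mul_inverse_cancel _ hu
  have hinv' := Ring.inverse_mul_cancel _ hu
  let A : Matrix Unit Unit R := Matrix.of fun _ _ => x
  let _ : Invertible A := ⟨Matrix.of fun _ _ => Ring.inverse x,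
    by ext; simp [A, Matrix.mul_apply, hinv'], by ext; simp [A, Matrix.mul_apply, hinv]⟩
  have hA : (⅟A : Matrix Unit Unit R) = Matrix.of fun _ _ => Ring.inverse x := rfl
  have hblock : M.submatrix e e = Matrix.fromBlocks A
      (Matrix.of fun _ j => M (e (.inl ())) (e (.inr j)))
      (Matrix.of fun i _ => M (e (.inr i)) (e (.inl ())))
      (Matrix.of fun i j => M (e (.inr i)) (e (.inr j))) := by
    ext (i | i) (j | j) <;> simp [A, hx]
  rw [← Matrix.det_submatrix_equiv_self e, hblock, Matrix.det_fromBlocks₁₁, hA]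
  congr 1
  · simp [A]
  · congr 1
    ext i j
    simp [Matrix.mul_apply]

/-- `Fin (n + 1)` with `0` split off. -/
def unitSumFinEquiv (n : ℕ) : Unit ⊕ Fin n ≃ Fin (n + 1) where
  toFun := Sum.elim (fun _ => 0) Fin.succ
  invFun := Fin.cases (.inl ()) .inr
  left_inv := by rintro (_ | i) <;> simp
  right_inv := by intro i; cases i using Fin.cases <;> simp

/-- `Fin (n + 1) ⊕ Unit` with `0` split off. -/
def unitSumBorderedEquiv (n : ℕ) : Unit ⊕ (Fin n ⊕ Unit) ≃ Fin (n + 1) ⊕ Unit :=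
  (Equiv.sumAssoc _ _ _).symm.trans (Equiv.sumCongr (unitSumFinEquiv n) (Equiv.refl _))

variable {K : Type*} [CommRing K] {m : ℕ} {X Z : LaxData K m} {a b : Fin m}

namespace IsSchurStep

theorem det_sepMatrix (h : IsSchurStep a b X Z) (n : ℕ) :
    (sepMatrix X a b (n + 1)).det = X.S a 0 b 0 * (sepMatrix Z a b n).det := by
  rw [det_eq_mul_det_schur (unitSumFinEquiv n) _ h.unit]
  congr 2
  ext i j
  exact (h.sep i j).symm

/-- The Schur complement has the new potentials as entries but minus the new eigenfunctions as last
column. The diagonal factor restores that column and accounts for the sign. -/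
theorem det_borderedPhi (h : IsSchurStep a b X Z) (n : ℕ) :
    (borderedPhi X a b (n + 1)).det = -X.S a 0 b 0 * (borderedPhi Z a b n).det := by
  rw [det_eq_mul_det_schur (unitSumBorderedEquiv n) _ h.unit]
  have : borderedPhi Z a b n = (Matrix.of fun i j =>
      borderedPhi X a b (n + 1) (unitSumBorderedEquiv n (.inr i)) (unitSumBorderedEquiv n (.inr j))
      - borderedPhi X a b (n + 1) (unitSumBorderedEquiv n (.inr i)) (.inl 0) *
        Ring.inverse (X.S a 0 b 0) *
        borderedPhi X a b (n + 1) (.inl 0) (unitSumBorderedEquiv n (.inr j))) *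
      Matrix.diagonal (Sum.elim 1 (-1)) := by
    ext i j
    rw [Matrix.mul_diagonal]
    rcases i with i | i <;> rcases j with j | j
    · exact (h.sep i j).trans (mul_one _).symm
    · exact (h.phi i).trans (mul_neg_one _).symm
    · exact (h.sep n j).trans (mul_one _).symm
    · exact (h.phi n).trans (mul_neg_one _).symm
  rw [this, Matrix.det_mul, Matrix.det_diagonal]
  simp only [Fintype.prod_sum_type, Sum.elim_inl, Sum.elim_inr, Pi.one_apply, Pi.neg_apply,
    Finset.prod_const_one, Finset.univ_unique, Finset.prod_singleton, mul_neg, mul_one,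
    neg_mul, neg_neg]
  rfl

/-- Here the sign sits in the last row, so the diagonal factor acts from the left. -/
theorem det_borderedPsi (h : IsSchurStep a b X Z) (n : ℕ) :
    (borderedPsi X a b (n + 1)).det = -X.S a 0 b 0 * (borderedPsi Z a b n).det := by
  rw [det_eq_mul_det_schur (unitSumBorderedEquiv n) _ h.unit]
  have : borderedPsi Z a b n = Matrix.diagonal (Sum.elim 1 (-1)) * (Matrix.of fun i j =>
      borderedPsi X a b (n + 1) (unitSumBorderedEquiv n (.inr i)) (unitSumBorderedEquiv n (.inr j))
      - borderedPsi X a b (n + 1) (unitSumBorderedEquiv n (.inr i)) (.inl 0) *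
        Ring.inverse (X.S a 0 b 0) *
        borderedPsi X a b (n + 1) (.inl 0) (unitSumBorderedEquiv n (.inr j))) := by
    ext i j
    rw [Matrix.diagonal_mul]
    rcases i with i | i <;> rcases j with j | j
    · exact (h.sep i j).trans (one_mul _).symm
    · exact (h.sep i n).trans (one_mul _).symm
    · exact (h.psi j).trans (neg_one_mul _).symm
    · exact (h.psi n).trans (neg_one_mul _).symm
  rw [this, Matrix.det_mul, Matrix.det_diagonal]
  simp only [Fintype.prod_sum_type, Sum.elim_inl, Sum.elim_inr, Pi.one_apply, Pi.neg_apply,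
    Finset.prod_const_one, Finset.univ_unique, Finset.prod_singleton, one_mul, mul_neg, mul_one,
    neg_mul, neg_neg]
  rfl

end IsSchurStep

theorem det_borderedPhi_zero (X : LaxData K m) (a b : Fin m) :
    (borderedPhi X a b 0).det = X.phi a 0 := by
  rw [← Matrix.det_submatrix_equiv_self (Equiv.emptySum (Fin 0) Unit).symm, Matrix.det_unique]
  rfl

theorem det_borderedPsi_zero (X : LaxData K m) (a b : Fin m) :
    (borderedPsi X a b 0).det = X.psi b 0 := by
  rw [← Matrix.det_submatrix_equiv_self (Equiv.emptySum (Fin 0) Unit).symm, Matrix.det_unique]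
  rfl

/-- The composition of `n` binary steps in terms of the initial data, in division-free form. -/
theorem schurSteps_det (n : ℕ) (X : ℕ → LaxData K m)
    (h : ∀ j < n, IsSchurStep a b (X j) (X (j + 1))) :
    IsUnit (sepMatrix (X 0) a b n).det ∧
    ∏ j ∈ Finset.range n, (X j).S a 0 b 0 = (sepMatrix (X 0) a b n).det ∧
    (X n).tau = (-1) ^ n * (sepMatrix (X 0) a b n).det * (X 0).tau ∧
    (X n).phi a 0 * (sepMatrix (X 0) a b n).det = (-1) ^ n * (borderedPhi (X 0) a b n).det ∧
    (X n).psi b 0 * (sepMatrix (X 0) a b n).det = (-1) ^ n * (borderedPsi (X 0) a b n).det ∧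
    (X n).S a 0 b 0 * (sepMatrix (X 0) a b n).det = (sepMatrix (X 0) a b (n + 1)).det := by
  induction n generalizing X with
  | zero =>
    rw [det_borderedPhi_zero, det_borderedPsi_zero, zero_add, Matrix.det_fin_one,
      Matrix.det_fin_zero]
    simp [sepMatrix]
  | succ n ih =>
    have h0 := h 0 n.succ_pos
    -- The first step is peeled off, not the last: the inductive formulas refer to the data after
    -- one step, and their determinants are Schur complements of the initial ones.
    obtain ⟨h1, h2, h3, h4, h5, h6⟩ := ih (fun j => X (j + 1)) fun j hj => h (j + 1) (by omega)
    simp only [zero_add] at h1 h2 h3 h4 h5 h6 h0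
    rw [h0.det_sepMatrix, h0.det_sepMatrix, h0.det_borderedPhi, h0.det_borderedPsi,
      Finset.prod_range_succ', h2, h3, h0.tau]
    refine ⟨h0.unit.mul h1, mul_comm _ _, by ring, ?_, ?_, ?_⟩
    · linear_combination (X 0).S a 0 b 0 * h4
    · linear_combination (X 0).S a 0 b 0 * h5
    · linear_combination (X 0).S a 0 b 0 * h6

end SchurInduction

theorem mainTheorem9 {K : Type*} [CommRing K] [Algebra ℚ K] [MultiTime K] {m : ℕ}
    (r : ℕ+) (a b : Fin m) (hab : a ≠ b) (n : ℕ) (X : ℕ → LaxData K m)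
    (hX : IsCKPSolution r (X 0)) (hstep : ∀ j < n, IsBinaryDB r a b (X j) (X (j + 1))) :
    IsUnit (sepMatrix (X 0) a b n).det ∧
    (X n).tau * Ring.inverse (X 0).tau = (-1) ^ n * ∏ j ∈ Finset.range n, (X j).S a 0 b 0 ∧
    (X n).tau * Ring.inverse (X 0).tau = (-1) ^ n * (sepMatrix (X 0) a b n).det ∧
    (X n).phi a 0 = (-1) ^ n * (borderedPhi (X 0) a b n).det
      * Ring.inverse (sepMatrix (X 0) a b n).det ∧
    (X n).psi b 0 = (-1) ^ n * (borderedPsi (X 0) a b n).det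
      * Ring.inverse (sepMatrix (X 0) a b n).det ∧
    (X n).S a 0 b 0 = (sepMatrix (X 0) a b (n + 1)).det
      * Ring.inverse (sepMatrix (X 0) a b n).det := by
  have hckp : ∀ j ≤ n, IsCKP r (X j) := by
    rintro (_ | j) hj
    · exact hX.toIsCKP
    · exact (hstep j hj).isCKP
  obtain ⟨h1, h2, h3, h4, h5, h6⟩ := schurSteps_det n X fun j hj =>
    (hstep j hj).isSchurStep hab (hckp j hj.le)
  have htau := Ring.mul_inverse_cancel _ hX.tau_unit
  refine ⟨h1, ?_, ?_, ?_, ?_, ?_⟩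
  · rw [h2, h3, mul_assoc, htau, mul_one]
  · rw [h3, mul_assoc, htau, mul_one]
  · rw [← h4, Ring.mul_inverse_cancel_right _ _ h1]
  · rw [← h5, Ring.mul_inverse_cancel_right _ _ h1]
  · rw [← h6, Ring.mul_inverse_cancel_right _ _ h1]
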